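/- **Setting.** Let $\mathcal M=(\mathcal N,\mathcal I)$ be a finite matroid of rank $k$, let $\mathcal U\subseteq\mathcal N$ be a pool of $n=|\mathcal U|$ items, and let $f:2^{\mathcal U}\to\mathbb R_{\ge 0}$ be monotone and submodular. The items of $\mathcal U$ arrive one per round in a uniformly random order. A (randomized) online algorithm knows $n$ and $k$ in advance; in each round it can query $f$ and membership in $\mathcal I$ on sets of items that have arrived so far. On the arrival of an item it decides irrevocably whether to select it, and it may also discard items that it selected before; a discarded item cannot be taken back. Let $A$ (the shortlist) be the set of all items that are ever selected, and let $D_t$ be the set of items selected in the first $t$ rounds and not discarded in those rounds. Let $\mathrm{OPT}=\max\{f(S): S\subseteq \mathcal U,\ S\in\mathcal I\}$. All expectations are over the arrival order and the internal randomness of the algorithm. **Theorem.** There are an absolute constant $c>0$ and an online algorithm that, on every such instance, achieves competitive ratio $c$ for the submodular matroid secretary problem both 1. in the preemption model: $D_t\in\mathcal I$ for every $t=0,\dots,n$ (always), and $\mathbb E[f(D_n)]\ge c\cdot \mathrm{OPT}$; and 2. with a shortlist of size at most $\eta(k)=k$: $|A|\le k$ (always), and $\mathbb E\big[\max\{f(S):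 S\subseteq A,\ S\in\mathcal I\}\big]\ge c\cdot \mathrm{OPT}$. -/

import Mathlib

universe u

/-- An instance of the submodular matroid secretary problem: a finite matroid, a finite pool of
items of the matroid, and a nonnegative monotone submodular function on the subsets of the pool. -/
structure SecretaryInstance (α : Type*) where
  M : Matroid α
  finite : M.Finite
  pool : Finset α
  pool_subset : (pool : Set α) ⊆ M.E
  f : Finset α → ℝ
  nonneg : ∀ S ⊆ pool, 0 ≤ f S
  mono : ∀ S ⊆ pool, ∀ T ⊆ pool, S ⊆ T → f S ≤ f T
  submod : ∀ [DecidableEq α], ∀ S ⊆ pool, ∀ T ⊆ pool, f (S ∪ T) + f (S ∩ T) ≤ f S + f T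

/-- What has been revealed when the item in position `t` has just arrived: the value and the
independence of every set of items that arrived in positions `≤ t`. Items are anonymous, they are
known to the algorithm through their arrival positions only. -/
structure RevealedData {n : ℕ} (t : Fin n) where
  value : {S : Finset (Fin n) // S ⊆ Finset.Iic t} → ℝ
  indep : {S : Finset (Fin n) // S ⊆ Finset.Iic t} → Prop

/-- A randomized online decision rule for `n` rounds. Its internal randomness is a seed with law
`seedLaw`. In round `t`, knowing the seed and the data revealed so far (which determine all of its
earlier decisions), it decides whether to select the arriving item, and which items to discard from
its current solution. -/
structure OnlineRule (n : ℕ) where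
  numSeeds : ℕ
  seedLaw : PMF (Fin numSeeds)
  select : Fin numSeeds → (t : Fin n) → RevealedData t → Bool
  discard : Fin numSeeds → (t : Fin n) → RevealedData t → Finset (Fin n)

/-- An online algorithm is told in advance only the number `n` of items and the rank `k` of the
matroid. -/
abbrev OnlineAlgorithm := (n k : ℕ) → OnlineRule n

namespace SecretaryInstance

variable {α : Type*} (P : SecretaryInstance α)

/-- The arrival orders: bijections from the rounds to the items of the pool. -/
abbrev Order := Fin P.pool.card ≃ P.pool

/-- The set of items that arrive in the rounds of `S`. -/
def items (σ : P.Order) (S : Finset (Fin P.pool.card)) : Finset α :=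
  S.map (σ.toEmbedding.trans (Function.Embedding.subtype _))

/-- The data revealed up to and including round `t` under the arrival order `σ`. -/
def revealed (σ : P.Order) (t : Fin P.pool.card) : RevealedData t where
  value S := P.f (P.items σ S.1)
  indep S := P.M.Indep (P.items σ S.1 : Set α)

open Classical in
/-- The maximum of `f` over the independent subsets of `A`. -/
noncomputable def best (A : Finset α) : ℝ :=
  (A.powerset.filter fun S : Finset α => P.M.Indep (S : Set α)).sup' ⟨∅, by simp⟩ P.f

/-- The optimal offline value. -/
noncomputable def opt : ℝ := P.best P.pool

section Run

variable (R : OnlineRule P.pool.card) (σ : P.Order) (ω : Fin R.numSeeds)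

/-- The rounds whose item is selected. The corresponding items form the shortlist. -/
def selectedRounds : Finset (Fin P.pool.card) :=
  Finset.univ.filter fun s => R.select ω s (P.revealed σ s) = true

/-- The shortlist: every item that the rule ever selects, whether or not it is discarded later. -/
def shortlist : Finset α := P.items σ (P.selectedRounds R σ ω)

/-- The rounds `s` among the first `t` rounds whose item is selected on its arrival and is not
discarded in any of the rounds from `s` on among these. -/
def heldRounds (t : ℕ) : Finset (Fin P.pool.card) :=
  (P.selectedRounds R σ ω).filter fun s => s.1 < t ∧
    ∀ r : Fin P.pool.card, s ≤ r → r.1 < t → s ∉ R.discard ω r (P.revealed σ r)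

/-- The current solution after the first `t` rounds: an item enters only on its arrival, and a
discarded item never returns. -/
def held (t : ℕ) : Finset α := P.items σ (P.heldRounds R σ ω t)

end Run

open Classical in
/-- Expectation over a uniformly random arrival order and an independent seed of the rule. -/
noncomputable def expect (R : OnlineRule P.pool.card)
    (X : P.Order → Fin R.numSeeds → ℝ) : ℝ :=
  (∑ σ : P.Order, ∑ ω, (R.seedLaw ω).toReal * X σ ω) / Fintype.card P.Order

end SecretaryInstance

namespace OnlineAlgorithm

/-- `alg` is `c`-competitive in the preemption model: its current solution is independent at all
times, and the final solution has expected value at least `c` times the optimum. -/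
def IsCompetitiveWithPreemption (alg : OnlineAlgorithm) (c : ℝ) : Prop :=
  ∀ (α : Type u) (P : SecretaryInstance α) (k : ℕ), P.M.eRank = k →
    (∀ σ ω t, P.M.Indep (P.held (alg P.pool.card k) σ ω t : Set α)) ∧
    c * P.opt ≤ P.expect (alg P.pool.card k)
      fun σ ω => P.f (P.held (alg P.pool.card k) σ ω P.pool.card)

/-- `alg` is `c`-competitive with a shortlist of size at most `η k`, `k` being the rank: the
shortlist never has more than `η k` items, and the expected value of its best independent subset is
at least `c` times the optimum. -/
def IsCompetitiveWithShortlist (alg : OnlineAlgorithm) (η : ℕ → ℕ) (c : ℝ) : Prop :=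
  ∀ (α : Type u) (P : SecretaryInstance α) (k : ℕ), P.M.eRank = k →
    (∀ σ ω, (P.shortlist (alg P.pool.card k) σ ω).card ≤ η k) ∧
    c * P.opt ≤ P.expect (alg P.pool.card k)
      fun σ ω => P.best (P.shortlist (alg P.pool.card k) σ ω)

end OnlineAlgorithm

/-!
The algorithm is deterministic. It uses at most `k` blocks of about `n / (8 * k)` rounds, each
starting in the first half, and picks at most one item per block, which bounds the shortlist by `k`.
It keeps an independent set `S`. The gain of an item `e` is the value of the best independent subset
of `S + e` minus `f S`; a picked item replaces `S` by that subset.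

Why the gains are large: for independent `S` and `O`, Hall's theorem assigns to the elements of `O`
that are spanned by `S` distinct elements of `S` against which they can be exchanged
(`Matroid.Indep.exists_injective_exchange`). By submodularity the gains of the elements of `O` then
add up to at least `f O - 2 * f S` (`SecretaryInstance.sub_le_sum_gain`). This is applied to the
items `O` of an optimal solution that have not arrived yet, whose value is on average at least half
the optimum (`SecretaryInstance.half_le_sum_inter`).

Why the pick of a block is good: given the past, the order of the remaining items is uniform. The
first third of a block is a sample. The pick is the first item of the second third whose gain
exceeds all of the sample, or else the first one of the last third whose gain is not below the
sample. Let `T` hold the `k` best remaining items and `T'` the next `k`. If exactly two items of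
`T ∪ T'` enter the block, `y ∈ T'` into the sample and `x ∈ T` into the second third when its gain
is larger than that of `y`, or into the last third when the two are equal, then the pick has at
least the gain of `x` (`le_pickScore`). The two selection phases handle ties, which cannot be broken
consistently because the items are anonymous. These events are disjoint, there are `k` choices of
`y` for each `x`, and counting permutations gives each of them probability of order `1 / k ^ 2`.
Hence the expected gain of the pick is of order `1 / k` times the sum over `T`
(`sum_le_sum_pickScore`). When `n` is less than a constant times `k`, blocks of one round without a
sample do the same (`sum_le_sum_pickScore_single`).

Together, each of the `r` blocks increases the expected value of `S` by a constant over `r` times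
`OPT / 2 - 2 * f S` in expectation, and summation gives the theorem.
-/

/-! ### The block algorithm -/

section Algorithm

variable {n : ℕ}

/-- A subset of `A` of maximum value among those that satisfy `I`. -/
noncomputable def bestSubset (v : Finset (Fin n) → ℝ) (I : Finset (Fin n) → Prop)
    (A : Finset (Fin n)) : Finset (Fin n) :=
  Classical.epsilon fun X => X ⊆ A ∧ I X ∧ ∀ Y ⊆ A, I Y → v Y ≤ v X

/-- The increase in value when the solution `S` is replaced by the best solution in `S ∪ {j}`. -/
noncomputable def gain (v : Finset (Fin n) → ℝ) (I : Finset (Fin n) → Prop)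
    (S : Finset (Fin n)) (j : Fin n) : ℝ :=
  v (bestSubset v I (insert j S)) - v S

/-- In the block of rounds `s, …, s + L - 1`, round `j` is acceptable if it comes after the sample
`s, …, s + h - 1` and its score reaches every score of the sample, strictly so if `j < s + 2 * h`.
-/
def Acceptable (h L s : ℕ) (γ : Fin n → ℝ) (j : Fin n) : Prop :=
  s + h ≤ j.1 ∧ j.1 < s + L ∧ ∀ i : Fin n, s ≤ i.1 → i.1 < s + h →
    γ i ≤ γ j ∧ (j.1 < s + 2 * h → γ i < γ j)

open Classical in
/-- The first acceptable round of the block that starts at `s`, as a set with at most one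
element. -/
noncomputable def pick (h L s : ℕ) (γ : Fin n → ℝ) : Finset (Fin n) :=
  Finset.univ.filter fun j => Acceptable h L s γ j ∧ ∀ i < j, ¬ Acceptable h L s γ i

open Classical in
/-- The solution after `b` blocks of length `L`. -/
noncomputable def blockSolution (h L : ℕ) (v : Finset (Fin n) → ℝ) (I : Finset (Fin n) → Prop) :
    ℕ → Finset (Fin n)
  | 0 => ∅
  | b + 1 =>
    if pick h L (b * L) (gain v I (blockSolution h L v I b)) = ∅ then blockSolution h L v I b
    else bestSubset v I
      (pick h L (b * L) (gain v I (blockSolution h L v I b)) ∪ blockSolution h L v I b)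

/-- The round `t` lies in one of the first `r` blocks and is the pick of its block. -/
def IsPicked (h L r : ℕ) (v : Finset (Fin n) → ℝ) (I : Finset (Fin n) → Prop) (t : Fin n) :
    Prop :=
  t.1 / L < r ∧ t ∈ pick h L (t.1 / L * L) (gain v I (blockSolution h L v I (t.1 / L)))

/-- The revealed value of the part of `X` that has arrived. -/
def RevealedData.valueOn {t : Fin n} (d : RevealedData t) (X : Finset (Fin n)) : ℝ :=
  d.value ⟨X ∩ Finset.Iic t, Finset.inter_subset_right⟩

/-- The revealed independence of the part of `X` that has arrived. -/
def RevealedData.indepOn {t : Fin n} (d : RevealedData t) (X : Finset (Fin n)) : Prop :=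
  d.indep ⟨X ∩ Finset.Iic t, Finset.inter_subset_right⟩

open Classical in
/-- The rule that treats the first `r` blocks of `L` rounds as above. It is deterministic.
If the picked item is not in the new solution, it is selected and discarded in the same round. -/
noncomputable def blockRule (n h L r : ℕ) : OnlineRule n where
  numSeeds := 1
  seedLaw := PMF.pure 0
  select _ t d := decide (IsPicked h L r d.valueOn d.indepOn t)
  discard _ t d :=
    if IsPicked h L r d.valueOn d.indepOn t then
      insert t (blockSolution h L d.valueOn d.indepOn (t.1 / L)) \
        bestSubset d.valueOn d.indepOn
          (insert t (blockSolution h L d.valueOn d.indepOn (t.1 / L)))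
    else ∅

variable {v v' : Finset (Fin n) → ℝ} {I I' : Finset (Fin n) → Prop}

theorem bestSubset_spec (hI : I ∅) (A : Finset (Fin n)) :
    bestSubset v I A ⊆ A ∧ I (bestSubset v I A) ∧
      ∀ Y ⊆ A, I Y → v Y ≤ v (bestSubset v I A) := by
  classical
  apply Classical.epsilon_spec (p := fun X => X ⊆ A ∧ I X ∧ ∀ Y ⊆ A, I Y → v Y ≤ v X)
  obtain ⟨X, hX, hmax⟩ := (A.powerset.filter I).exists_max_image v ⟨∅, by simp [hI]⟩
  simp only [Finset.mem_filter, Finset.mem_powerset] at hX hmax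
  exact ⟨X, hX.1, hX.2, fun Y h1 h2 => hmax Y ⟨h1, h2⟩⟩

/-- Two valuations with their independence predicates agree on the subsets of `D`. -/
def AgreeOn (D : Finset (Fin n)) (v v' : Finset (Fin n) → ℝ) (I I' : Finset (Fin n) → Prop) :
    Prop :=
  ∀ X ⊆ D, v X = v' X ∧ (I X ↔ I' X)

theorem AgreeOn.subset {D D' : Finset (Fin n)} (H : AgreeOn D v v' I I') (hD : D' ⊆ D) :
    AgreeOn D' v v' I I' := fun X hX => H X (hX.trans hD)

theorem AgreeOn.bestSubset_eq {D : Finset (Fin n)} (H : AgreeOn D v v' I I') :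
    bestSubset v I D = bestSubset v' I' D := by
  unfold bestSubset
  congr 1
  funext X
  refine propext (and_congr_right fun hX => and_congr (H X hX).2 (forall_congr' fun Y => ?_))
  refine forall_congr' fun hY => ?_
  rw [(H X hX).1, (H Y hY).1, (H Y hY).2]

theorem AgreeOn.gain_eq {D S : Finset (Fin n)} (H : AgreeOn D v v' I I') (hI : I ∅)
    (hS : S ⊆ D) {j : Fin n} (hj : j ∈ D) : gain v I S j = gain v' I' S j := by
  have hD : insert j S ⊆ D := Finset.insert_subset hj hS
  unfold gain
  rw [← (H.subset hD).bestSubset_eq, (H S hS).1,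
    (H _ ((bestSubset_spec hI (insert j S)).1.trans hD)).1]

theorem gain_nonneg (hI : I ∅) {S : Finset (Fin n)} (hS : I S) (j : Fin n) :
    0 ≤ gain v I S j :=
  sub_nonneg.2 ((bestSubset_spec hI _).2.2 S (Finset.subset_insert _ _) hS)

theorem acceptable_congr {h L s : ℕ} {γ γ' : Fin n → ℝ} {j : Fin n}
    (H : ∀ i ≤ j, γ i = γ' i) : Acceptable h L s γ j ↔ Acceptable h L s γ' j := by
  refine and_congr_right fun h1 => and_congr_right fun _ => forall_congr' fun i =>
    forall_congr' fun _ => forall_congr' fun h2 => ?_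
  rw [H i (Fin.le_def.2 (by omega)), H j le_rfl]

theorem mem_pick_congr {h L s : ℕ} {γ γ' : Fin n → ℝ} {j : Fin n}
    (H : ∀ i ≤ j, γ i = γ' i) : j ∈ pick h L s γ ↔ j ∈ pick h L s γ' := by
  simp only [pick, Finset.mem_filter, Finset.mem_univ, true_and]
  refine and_congr (acceptable_congr H) (forall_congr' fun i => forall_congr' fun hi => ?_)
  rw [acceptable_congr fun l hl => H l (hl.trans hi.le)]

theorem bounds_of_mem_pick {h L s : ℕ} {γ : Fin n → ℝ} {j : Fin n} (hj : j ∈ pick h L s γ) :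
    s ≤ j.1 ∧ j.1 < s + L := by
  simp only [pick, Finset.mem_filter, Finset.mem_univ, true_and] at hj
  exact ⟨by have := hj.1.1; omega, hj.1.2.1⟩

theorem eq_of_mem_pick {h L s : ℕ} {γ : Fin n → ℝ} {i j : Fin n} (hi : i ∈ pick h L s γ)
    (hj : j ∈ pick h L s γ) : i = j := by
  simp only [pick, Finset.mem_filter, Finset.mem_univ, true_and] at hi hj
  rcases lt_trichotomy i j with hij | hij | hij
  · exact absurd hi.1 (hj.2 i hij)
  · exact hij
  · exact absurd hj.1 (hi.2 j hij)

theorem pick_eq_singleton {h L s : ℕ} {γ : Fin n → ℝ} {j : Fin n} (hj : j ∈ pick h L s γ) :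
    pick h L s γ = {j} :=
  Finset.eq_singleton_iff_unique_mem.2 ⟨hj, fun _ hi => eq_of_mem_pick hi hj⟩

/-- The rounds before `s`. -/
def past (n s : ℕ) : Finset (Fin n) := Finset.univ.filter fun i => i.1 < s

theorem mem_past {s : ℕ} {i : Fin n} : i ∈ past n s ↔ i.1 < s := by simp [past]

theorem past_mono {s t : ℕ} (h : s ≤ t) : past n s ⊆ past n t := fun i hi => by
  rw [mem_past] at *; omega

theorem blockSolution_spec {h L : ℕ} (hI : I ∅) (b : ℕ) :
    blockSolution h L v I b ⊆ past n (b * L) ∧ I (blockSolution h L v I b) := by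
  induction b with
  | zero => simpa [blockSolution] using hI
  | succ b ih =>
    have hle : b * L ≤ (b + 1) * L := Nat.mul_le_mul_right _ (Nat.le_succ b)
    rw [blockSolution]
    split_ifs
    · exact ⟨ih.1.trans (past_mono hle), ih.2⟩
    · refine ⟨(bestSubset_spec hI _).1.trans (Finset.union_subset (fun j hj => ?_)
        (ih.1.trans (past_mono hle))), (bestSubset_spec hI _).2.1⟩
      rw [mem_past, Nat.succ_mul]
      exact (bounds_of_mem_pick hj).2

/-- The solution after `b` blocks depends only on what was revealed in these blocks. -/
theorem AgreeOn.blockSolution_eq {h L : ℕ} (hI : I ∅) {b : ℕ}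
    (H : AgreeOn (past n (b * L)) v v' I I') :
    blockSolution h L v I b = blockSolution h L v' I' b := by
  induction b with
  | zero => rfl
  | succ b ih =>
    have hle : b * L ≤ (b + 1) * L := Nat.mul_le_mul_right _ (Nat.le_succ b)
    have hS := (blockSolution_spec (v := v) (h := h) (L := L) hI b).1
    rw [blockSolution, blockSolution, ← ih (H.subset (past_mono hle))]
    set S := blockSolution h L v I b
    have hpick : pick h L (b * L) (gain v I S) = pick h L (b * L) (gain v' I' S) := by
      ext j
      by_cases hj : j.1 < (b + 1) * L
      · refine mem_pick_congr fun i hi => H.gain_eq hI (hS.trans (past_mono hle)) ?_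
        exact mem_past.2 (lt_of_le_of_lt hi hj)
      · rw [Nat.succ_mul] at hj
        exact iff_of_false (fun hc => hj (bounds_of_mem_pick hc).2)
          (fun hc => hj (bounds_of_mem_pick hc).2)
    rw [← hpick]
    split_ifs
    · rfl
    · refine (H.subset (Finset.union_subset (fun j hj => ?_)
        (hS.trans (past_mono hle)))).bestSubset_eq
      rw [mem_past, Nat.succ_mul]
      exact (bounds_of_mem_pick hj).2

theorem AgreeOn.isPicked_iff {h L r : ℕ} (hI : I ∅) {t : Fin n}
    (H : AgreeOn (Finset.Iic t) v v' I I') :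
    blockSolution h L v I (t.1 / L) = blockSolution h L v' I' (t.1 / L) ∧
      (IsPicked h L r v I t ↔ IsPicked h L r v' I' t) := by
  have hpast : past n (t.1 / L * L) ⊆ Finset.Iic t := fun i hi => by
    have := Nat.div_mul_le_self t.1 L
    rw [mem_past] at hi
    exact Finset.mem_Iic.2 (Fin.le_def.2 (by omega))
  have hS := (H.subset hpast).blockSolution_eq (h := h) (L := L) hI
  refine ⟨hS, and_congr_right fun _ => ?_⟩
  rw [← hS]
  exact mem_pick_congr fun i hi =>
    H.gain_eq hI ((blockSolution_spec hI _).1.trans hpast) (Finset.mem_Iic.2 hi)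

/-- The total score of the pick, so `0` if there is none. -/
noncomputable def pickScore (h L s : ℕ) (γ : Fin n → ℝ) : ℝ := ∑ j ∈ pick h L s γ, γ j

theorem blockSolution_succ_value {h L b : ℕ} :
    v (blockSolution h L v I (b + 1)) = v (blockSolution h L v I b) +
      pickScore h L (b * L) (gain v I (blockSolution h L v I b)) := by
  rw [blockSolution, pickScore]
  split_ifs with hp
  · simp [hp]
  · obtain ⟨j, hj⟩ := Finset.nonempty_iff_ne_empty.2 hp
    rw [pick_eq_singleton hj, Finset.sum_singleton, gain, Finset.insert_eq]
    ring

end Algorithm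

/-! ### Runs of the block algorithm -/

namespace SecretaryInstance

variable {α : Type*} (P : SecretaryInstance α)

/-- The value of a set of rounds under the arrival order `σ`. -/
def roundValue (σ : P.Order) (X : Finset (Fin P.pool.card)) : ℝ := P.f (P.items σ X)

/-- The independence of a set of rounds under the arrival order `σ`. -/
def RoundIndep (σ : P.Order) (X : Finset (Fin P.pool.card)) : Prop :=
  P.M.Indep (P.items σ X : Set α)

theorem roundIndep_empty (σ : P.Order) : P.RoundIndep σ ∅ := by
  simp [RoundIndep, items]

theorem agreeOn_revealed (σ : P.Order) (t : Fin P.pool.card) :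
    AgreeOn (Finset.Iic t) (P.roundValue σ) (P.revealed σ t).valueOn (P.RoundIndep σ)
      (P.revealed σ t).indepOn := by
  intro X hX
  simp [roundValue, RoundIndep, revealed, RevealedData.valueOn, RevealedData.indepOn,
    Finset.inter_eq_left.2 hX]

theorem heldRounds_zero (R : OnlineRule P.pool.card) (σ : P.Order) (ω : Fin R.numSeeds) :
    P.heldRounds R σ ω 0 = ∅ := by
  simp [heldRounds]

theorem heldRounds_of_le (R : OnlineRule P.pool.card) (σ : P.Order) (ω : Fin R.numSeeds) {t : ℕ}
    (ht : P.pool.card ≤ t) : P.heldRounds R σ ω t = P.heldRounds R σ ω P.pool.card := by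
  ext s
  simp only [heldRounds, Finset.mem_filter]
  have hs : ∀ r : Fin P.pool.card, r.1 < t := fun r => r.2.trans_le ht
  simp [hs]

open Classical in
theorem heldRounds_succ (R : OnlineRule P.pool.card) (σ : P.Order) (ω : Fin R.numSeeds)
    (t : Fin P.pool.card) :
    P.heldRounds R σ ω (t.1 + 1) =
      (if R.select ω t (P.revealed σ t) = true then insert t (P.heldRounds R σ ω t.1)
        else P.heldRounds R σ ω t.1) \ R.discard ω t (P.revealed σ t) := by
  ext s
  have key : s ∈ P.heldRounds R σ ω (t.1 + 1) ↔
      (s ∈ P.heldRounds R σ ω t.1 ∨ (s = t ∧ R.select ω t (P.revealed σ t) = true)) ∧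
        s ∉ R.discard ω t (P.revealed σ t) := by
    simp only [heldRounds, selectedRounds, Finset.mem_filter, Finset.mem_univ, true_and]
    constructor
    · rintro ⟨h1, h2, h3⟩
      have hst : s ≤ t := Fin.le_def.2 (by omega)
      refine ⟨?_, h3 t hst (by omega)⟩
      rcases hst.lt_or_eq with hlt | rfl
      · exact Or.inl ⟨h1, hlt, fun r hr hr' => h3 r hr (by omega)⟩
      · exact Or.inr ⟨rfl, h1⟩
    · rintro ⟨⟨h1, h2, h3⟩ | ⟨rfl, h1⟩, h4⟩
      · refine ⟨h1, by omega, fun r hr hr' => ?_⟩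
        rcases (Nat.lt_succ_iff.1 hr').lt_or_eq with hlt | heq
        · exact h3 r hr hlt
        · rwa [Fin.ext heq]
      · refine ⟨h1, by omega, fun r hr hr' => ?_⟩
        rwa [le_antisymm (Fin.le_def.2 (by omega)) hr]
  rw [key]
  split_ifs with hsel
  · simp [hsel, or_comm]
  · simp [hsel]

variable {h L r : ℕ} (σ : P.Order)

theorem select_blockRule (ω : Fin (blockRule P.pool.card h L r).numSeeds)
    (t : Fin P.pool.card) :
    (blockRule P.pool.card h L r).select ω t (P.revealed σ t) = true ↔
      IsPicked h L r (P.roundValue σ) (P.RoundIndep σ) t := by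
  rw [((P.agreeOn_revealed σ t).isPicked_iff (P.roundIndep_empty σ)).2]
  simp [blockRule]

open Classical in
theorem discard_blockRule (ω : Fin (blockRule P.pool.card h L r).numSeeds)
    (t : Fin P.pool.card) :
    (blockRule P.pool.card h L r).discard ω t (P.revealed σ t) =
      if IsPicked h L r (P.roundValue σ) (P.RoundIndep σ) t then
        insert t (blockSolution h L (P.roundValue σ) (P.RoundIndep σ) (t.1 / L)) \
          bestSubset (P.roundValue σ) (P.RoundIndep σ)
            (insert t (blockSolution h L (P.roundValue σ) (P.RoundIndep σ) (t.1 / L)))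
      else ∅ := by
  have H := P.agreeOn_revealed σ t
  have H1 := H.isPicked_iff (h := h) (L := L) (r := r) (P.roundIndep_empty σ)
  have hsub : insert t (blockSolution h L (P.roundValue σ) (P.RoundIndep σ) (t.1 / L)) ⊆
      Finset.Iic t := by
    refine Finset.insert_subset (by simp) (((blockSolution_spec (P.roundIndep_empty σ) _).1).trans
      fun i hi => ?_)
    have := Nat.div_mul_le_self t.1 L
    rw [mem_past] at hi
    exact Finset.mem_Iic.2 (Fin.le_def.2 (by omega))
  rw [H1.2, (H.subset hsub).bestSubset_eq, H1.1]
  rfl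

open Classical in
/-- Inside a block the held rounds are the solution after the preceding blocks until the pick
arrives, and the solution after this block from then on. -/
theorem heldRounds_blockRule_in_block (ω : Fin (blockRule P.pool.card h L r).numSeeds) {b : ℕ}
    (hb : b < r)
    (hstart : P.heldRounds (blockRule P.pool.card h L r) σ ω (b * L) =
      blockSolution h L (P.roundValue σ) (P.RoundIndep σ) b)
    {t : ℕ} (hbt : b * L ≤ t) (htL : t ≤ (b + 1) * L) (htn : t ≤ P.pool.card) :
    P.heldRounds (blockRule P.pool.card h L r) σ ω t =
      if ∃ p ∈ pick h L (b * L) (gain (P.roundValue σ) (P.RoundIndep σ)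
          (blockSolution h L (P.roundValue σ) (P.RoundIndep σ) b)), p.1 < t
      then blockSolution h L (P.roundValue σ) (P.RoundIndep σ) (b + 1)
      else blockSolution h L (P.roundValue σ) (P.RoundIndep σ) b := by
  induction t, hbt using Nat.le_induction with
  | base =>
    rw [hstart, if_neg]
    rintro ⟨p, hp, hlt⟩
    have := (bounds_of_mem_pick hp).1
    omega
  | succ t hbt ih =>
    specialize ih (by omega) (by omega)
    have hdiv : t / L = b := by
      have hL : 0 < L := by
        rcases Nat.eq_zero_or_pos L with h0 | h0
        · subst h0; omega
        · exact h0
      exact (Nat.div_eq_iff hL).2 ⟨hbt, by rw [Nat.succ_mul] at htL; omega⟩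
    have hstep := P.heldRounds_succ (blockRule P.pool.card h L r) σ ω ⟨t, by omega⟩
    simp only [P.select_blockRule σ ω, P.discard_blockRule σ ω] at hstep
    rw [hstep, ih]
    simp only [hdiv, IsPicked, hb, true_and]
    set S := blockSolution h L (P.roundValue σ) (P.RoundIndep σ) b with hS
    set Q := pick h L (b * L) (gain (P.roundValue σ) (P.RoundIndep σ) S) with hQ
    by_cases hpick : (⟨t, by omega⟩ : Fin P.pool.card) ∈ Q
    · have hQ1 : Q = {⟨t, by omega⟩} := pick_eq_singleton hpick
      rw [if_pos hpick, if_pos hpick, if_neg, if_pos ⟨_, hpick, Nat.lt_succ_self t⟩,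
        Finset.sdiff_sdiff_eq_self (bestSubset_spec (P.roundIndep_empty σ) _).1, blockSolution,
        ← hS, ← hQ, hQ1, if_neg (Finset.singleton_ne_empty _), ← Finset.insert_eq]
      rintro ⟨p, hp, hlt⟩
      have := Fin.ext_iff.1 (eq_of_mem_pick hp hpick)
      simp only at this
      omega
    · rw [if_neg hpick, if_neg hpick, Finset.sdiff_empty]
      congr 1
      refine propext (exists_congr fun p => and_congr_right fun hp => ?_)
      have : p.1 ≠ t := fun hpt => hpick (by convert hp; exact hpt.symm)
      omega

theorem heldRounds_blockRule_start (ω : Fin (blockRule P.pool.card h L r).numSeeds)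
    (hn : r * L ≤ P.pool.card) {b : ℕ} (hb : b ≤ r) :
    P.heldRounds (blockRule P.pool.card h L r) σ ω (b * L) =
      blockSolution h L (P.roundValue σ) (P.RoundIndep σ) b := by
  classical
  induction b with
  | zero => rw [Nat.zero_mul, heldRounds_zero, blockSolution]
  | succ b ih =>
    have hle : (b + 1) * L ≤ P.pool.card := (Nat.mul_le_mul_right _ hb).trans hn
    rw [P.heldRounds_blockRule_in_block σ ω (by omega) (ih (by omega))
      (Nat.mul_le_mul_right _ (Nat.le_succ b)) le_rfl hle]
    split_ifs with hp
    · rfl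
    · rw [blockSolution, if_pos]
      by_contra hne
      obtain ⟨p, hp'⟩ := Finset.nonempty_iff_ne_empty.2 hne
      exact hp ⟨p, hp', by rw [Nat.succ_mul]; exact (bounds_of_mem_pick hp').2⟩

theorem heldRounds_blockRule_end (ω : Fin (blockRule P.pool.card h L r).numSeeds) (hL : 0 < L)
    (hn : r * L ≤ P.pool.card) {t : ℕ} (ht : r * L ≤ t) :
    P.heldRounds (blockRule P.pool.card h L r) σ ω t =
      blockSolution h L (P.roundValue σ) (P.RoundIndep σ) r := by
  classical
  induction t, ht using Nat.le_induction with
  | base => exact P.heldRounds_blockRule_start σ ω hn le_rfl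
  | succ t ht ih =>
    by_cases htn : t < P.pool.card
    · have hnot : ¬ IsPicked h L r (P.roundValue σ) (P.RoundIndep σ) ⟨t, htn⟩ := fun hp => by
        have := (Nat.le_div_iff_mul_le hL).2 ht
        have := hp.1
        simp only at this
        omega
      have hstep := P.heldRounds_succ (blockRule P.pool.card h L r) σ ω ⟨t, htn⟩
      simp only [P.select_blockRule σ ω, P.discard_blockRule σ ω, if_neg hnot] at hstep
      rw [hstep, Finset.sdiff_empty, ih]
    · rw [P.heldRounds_of_le _ σ ω (by omega : P.pool.card ≤ t + 1),
        ← P.heldRounds_of_le _ σ ω (by omega : P.pool.card ≤ t), ih]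

theorem indep_held_blockRule (ω : Fin (blockRule P.pool.card h L r).numSeeds) (hL : 0 < L)
    (hn : r * L ≤ P.pool.card) (t : ℕ) :
    P.M.Indep (P.held (blockRule P.pool.card h L r) σ ω t : Set α) := by
  classical
  have hI : ∀ b, P.RoundIndep σ (blockSolution h L (P.roundValue σ) (P.RoundIndep σ) b) :=
    fun b => (blockSolution_spec (P.roundIndep_empty σ) b).2
  rcases le_or_gt (r * L) t with ht | ht
  · rw [held, P.heldRounds_blockRule_end σ ω hL hn ht]
    exact hI r
  · have hb : t / L < r := (Nat.div_lt_iff_lt_mul hL).2 ht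
    have hlt := Nat.lt_mul_div_succ t hL
    rw [held, P.heldRounds_blockRule_in_block σ ω hb
      (P.heldRounds_blockRule_start σ ω hn hb.le) (Nat.div_mul_le_self t L)
      (by rw [Nat.mul_comm]; exact hlt.le) (by omega)]
    split_ifs
    · exact hI _
    · exact hI _

theorem card_shortlist_blockRule_le (ω : Fin (blockRule P.pool.card h L r).numSeeds) :
    (P.shortlist (blockRule P.pool.card h L r) σ ω).card ≤ r := by
  rw [shortlist, items, Finset.card_map]
  refine (Finset.card_le_card_of_injOn (t := Finset.range r) (fun t => t.1 / L) (fun t ht => ?_)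
    fun t ht t' ht' htt => ?_).trans_eq (Finset.card_range r)
  · simp only [selectedRounds, Finset.coe_filter, Finset.mem_univ, true_and, Set.mem_ofPred_eq,
      P.select_blockRule σ ω] at ht
    exact Finset.mem_coe.2 (Finset.mem_range.2 ht.1)
  · simp only [selectedRounds, Finset.coe_filter, Finset.mem_univ, true_and, Set.mem_ofPred_eq,
      P.select_blockRule σ ω] at ht ht'
    simp only at htt
    have h2 := ht'.2
    rw [← htt] at h2
    exact eq_of_mem_pick ht.2 h2

end SecretaryInstance

/-! ### Counting permutations with prescribed values -/

/-- If a set `Q` of bijections is closed under exchanging the values at two points of `D`, and each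
member of `Q` takes the value `z` on `D`, then it takes it at each point of `D` equally often. -/
theorem card_filter_apply_eq_mul_card {ι β : Type*} [DecidableEq ι] [DecidableEq β]
    (Q : Finset (ι ≃ β)) (D : Finset ι)
    (hQ : ∀ σ ∈ Q, ∀ l ∈ D, ∀ l' ∈ D, (Equiv.swap l l').trans σ ∈ Q) {z : β}
    (hz : ∀ σ ∈ Q, σ.symm z ∈ D) {l : ι} (hl : l ∈ D) :
    (Q.filter fun σ => σ l = z).card * D.card = Q.card := by
  have hfib : Q.card = ∑ l' ∈ D, (Q.filter fun σ => σ.symm z = l').card :=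
    Finset.card_eq_sum_card_fiberwise (f := fun σ : ι ≃ β => σ.symm z) hz
  rw [hfib, Finset.sum_const_nat (m := (Q.filter fun σ => σ l = z).card), mul_comm]
  intro l' hl'
  refine Finset.card_bij' (fun σ _ => (Equiv.swap l l').trans σ)
    (fun σ _ => (Equiv.swap l l').trans σ) ?_ ?_ ?_ ?_
  · intro σ hσ
    rw [Finset.mem_filter] at hσ ⊢
    refine ⟨hQ σ hσ.1 l hl l' hl', ?_⟩
    simp [← hσ.2]
  · intro σ hσ
    rw [Finset.mem_filter] at hσ ⊢
    refine ⟨hQ σ hσ.1 l hl l' hl', ?_⟩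
    rw [Equiv.symm_trans_apply, ← hσ.2]
    simp
  · intro σ _
    ext i
    simp
  · intro σ _
    ext i
    simp

section Future

variable {n s : ℕ}

/-- The rounds from `s` on. -/
def future (n s : ℕ) : Finset (Fin n) := Finset.univ.filter fun i => s ≤ i.1

theorem mem_future {i : Fin n} : i ∈ future n s ↔ s ≤ i.1 := by simp [future]

theorem card_filter_val_mem_Ico {a b : ℕ} (hb : b ≤ n) :
    (Finset.univ.filter fun i : Fin n => a ≤ i.1 ∧ i.1 < b).card = b - a := by
  rw [← Nat.card_Ico, ← Finset.card_map Fin.valEmbedding]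
  congr 1
  ext m
  simp only [Finset.mem_map, Finset.mem_filter, Finset.mem_univ, true_and, Fin.valEmbedding_apply,
    Finset.mem_Ico]
  exact ⟨fun ⟨i, hi, him⟩ => him ▸ hi, fun hm => ⟨⟨m, by omega⟩, hm, rfl⟩⟩

theorem card_future : (future n s).card = n - s := by
  rw [← card_filter_val_mem_Ico (a := s) le_rfl]
  congr 1
  ext i
  simp [future]

/-- The permutations of the rounds that fix every round before `s`. -/
def futurePerms (n s : ℕ) : Finset (Equiv.Perm (Fin n)) :=
  Finset.univ.filter fun π => ∀ i : Fin n, i.1 < s → π i = i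

theorem mem_futurePerms {π : Equiv.Perm (Fin n)} :
    π ∈ futurePerms n s ↔ ∀ i : Fin n, i.1 < s → π i = i := by simp [futurePerms]

theorem swap_trans_mem_futurePerms {π : Equiv.Perm (Fin n)} (hπ : π ∈ futurePerms n s)
    {l l' : Fin n} (hl : l ∈ future n s) (hl' : l' ∈ future n s) :
    (Equiv.swap l l').trans π ∈ futurePerms n s := by
  rw [mem_future] at hl hl'
  rw [mem_futurePerms] at hπ ⊢
  intro i hi
  rw [Equiv.trans_apply, Equiv.swap_apply_of_ne_of_ne, hπ i hi]
  · rintro rfl; omega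
  · rintro rfl; omega

theorem symm_mem_future {π : Equiv.Perm (Fin n)} (hπ : π ∈ futurePerms n s) {x : Fin n}
    (hx : x ∈ future n s) : π.symm x ∈ future n s := by
  rw [mem_future] at hx ⊢
  by_contra hlt
  have := mem_futurePerms.1 hπ (π.symm x) (by omega)
  rw [Equiv.apply_symm_apply] at this
  rw [← this] at hlt
  exact hlt hx

theorem card_futurePerms_pos : 0 < (futurePerms n s).card :=
  Finset.card_pos.2 ⟨1, by simp [mem_futurePerms]⟩

theorem card_futurePerms_one {x i : Fin n} (hx : x ∈ future n s) (hi : i ∈ future n s) :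
    ((futurePerms n s).filter fun π => π i = x).card * (n - s) = (futurePerms n s).card := by
  rw [← card_future]
  exact card_filter_apply_eq_mul_card _ _
    (fun π hπ l hl l' hl' => swap_trans_mem_futurePerms hπ hl hl')
    (fun π hπ => symm_mem_future hπ hx) hi

theorem card_futurePerms_two {x y i j : Fin n} (hx : x ∈ future n s) (hy : y ∈ future n s)
    (hi : i ∈ future n s) (hj : j ∈ future n s) (hxy : x ≠ y) (hij : i ≠ j) :
    ((futurePerms n s).filter fun π => π i = x ∧ π j = y).card * ((n - s) * (n - s - 1)) =
      (futurePerms n s).card := by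
  rw [← card_futurePerms_one hx hi, ← card_filter_apply_eq_mul_card
    ((futurePerms n s).filter fun π => π i = x) ((future n s).erase i) (z := y) (l := j),
    Finset.card_erase_of_mem hi, card_future, Finset.filter_filter]
  · ring
  · intro π hπ l hl l' hl'
    rw [Finset.mem_filter] at hπ ⊢
    rw [Finset.mem_erase] at hl hl'
    refine ⟨swap_trans_mem_futurePerms hπ.1 hl.2 hl'.2, ?_⟩
    rw [Equiv.trans_apply, Equiv.swap_apply_of_ne_of_ne hl.1.symm hl'.1.symm, hπ.2]
  · intro π hπ
    rw [Finset.mem_filter] at hπ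
    refine Finset.mem_erase.2 ⟨fun h => hxy ?_, symm_mem_future hπ.1 hy⟩
    rw [← hπ.2, ← h, Equiv.apply_symm_apply]
  · exact Finset.mem_erase.2 ⟨hij.symm, hj⟩

theorem card_futurePerms_three {x y z i j l : Fin n} (hz : z ∈ future n s)
    (hi : i ∈ future n s) (hj : j ∈ future n s) (hl : l ∈ future n s)
    (hxz : x ≠ z) (hyz : y ≠ z) (hij : i ≠ j) (hil : i ≠ l)
    (hjl : j ≠ l) :
    ((futurePerms n s).filter fun π => (π i = x ∧ π j = y) ∧ π l = z).card * (n - s - 2) =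
      ((futurePerms n s).filter fun π => π i = x ∧ π j = y).card := by
  rw [← card_filter_apply_eq_mul_card
    ((futurePerms n s).filter fun π => π i = x ∧ π j = y) (((future n s).erase i).erase j)
    (z := z) (l := l), Finset.card_erase_of_mem (Finset.mem_erase.2 ⟨hij.symm, hj⟩),
    Finset.card_erase_of_mem hi, card_future, Finset.filter_filter]
  · rfl
  · intro π hπ a ha a' ha'
    rw [Finset.mem_filter] at hπ ⊢
    rw [Finset.mem_erase, Finset.mem_erase] at ha ha'
    refine ⟨swap_trans_mem_futurePerms hπ.1 ha.2.2 ha'.2.2, ?_, ?_⟩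
    · rw [Equiv.trans_apply, Equiv.swap_apply_of_ne_of_ne ha.2.1.symm ha'.2.1.symm, hπ.2.1]
    · rw [Equiv.trans_apply, Equiv.swap_apply_of_ne_of_ne ha.1.symm ha'.1.symm, hπ.2.2]
  · intro π hπ
    rw [Finset.mem_filter] at hπ
    refine Finset.mem_erase.2 ⟨fun h => hyz ?_, Finset.mem_erase.2 ⟨fun h => hxz ?_,
      symm_mem_future hπ.1 hz⟩⟩
    · rw [← hπ.2.2, ← h, Equiv.apply_symm_apply]
    · rw [← hπ.2.1, ← h, Equiv.apply_symm_apply]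
  · exact Finset.mem_erase.2 ⟨hjl.symm, Finset.mem_erase.2 ⟨hil.symm, hl⟩⟩

end Future

/-! ### Top sets -/

theorem exists_top_subset {ι : Type*} [DecidableEq ι] (D : Finset ι) (γ : ι → ℝ) {m : ℕ}
    (hm : m ≤ D.card) : ∃ T ⊆ D, T.card = m ∧ ∀ x ∈ T, ∀ y ∈ D \ T, γ y ≤ γ x := by
  induction m with
  | zero => exact ⟨∅, by simp, rfl, by simp⟩
  | succ m ih =>
    obtain ⟨T, hTD, hT, htop⟩ := ih (by omega)
    have hne : (D \ T).Nonempty := by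
      rw [← Finset.card_pos, Finset.card_sdiff_of_subset hTD]; omega
    obtain ⟨a, ha, hmax⟩ := (D \ T).exists_max_image γ hne
    have ha' := Finset.mem_sdiff.1 ha
    refine ⟨insert a T, Finset.insert_subset ha'.1 hTD, by
      rw [Finset.card_insert_of_notMem ha'.2, hT], fun x hx y hy => ?_⟩
    have hy' : y ∈ D \ T :=
      Finset.sdiff_subset_sdiff subset_rfl (Finset.subset_insert _ _) hy
    rcases Finset.mem_insert.1 hx with rfl | hx
    · exact hmax y hy'
    · exact htop x hx y hy'

theorem sum_le_sum_of_top {ι : Type*} [DecidableEq ι] {D T O : Finset ι} {γ : ι → ℝ}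
    (hγ : ∀ i, 0 ≤ γ i) (htop : ∀ x ∈ T, ∀ y ∈ D \ T, γ y ≤ γ x) (hO : O ⊆ D)
    (hcard : O.card ≤ T.card) : ∑ o ∈ O, γ o ≤ ∑ x ∈ T, γ x := by
  have hc : (O \ T).card ≤ (T \ O).card := by
    rw [Finset.card_sdiff, Finset.card_sdiff, Finset.inter_comm]
    omega
  rw [← Finset.sum_inter_add_sum_sdiff O T, ← Finset.sum_inter_add_sum_sdiff T O,
    Finset.inter_comm T O]
  refine add_le_add le_rfl ?_
  rcases (O \ T).eq_empty_or_nonempty with he | hne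
  · rw [he, Finset.sum_empty]
    exact Finset.sum_nonneg fun i _ => hγ i
  · obtain ⟨a, ha, hmax⟩ := (O \ T).exists_max_image γ hne
    calc ∑ o ∈ O \ T, γ o ≤ (O \ T).card • γ a := Finset.sum_le_card_nsmul _ _ _ hmax
      _ ≤ (T \ O).card • γ a := nsmul_le_nsmul_left (hγ a) hc
      _ ≤ ∑ x ∈ T \ O, γ x := Finset.card_nsmul_le_sum _ _ _ fun x hx =>
        htop x (Finset.mem_sdiff.1 hx).1 a (Finset.sdiff_subset_sdiff hO subset_rfl ha)

/-! ### The expected score of a pick -/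

section Pick

variable {n : ℕ}

theorem pickScore_nonneg {h L s : ℕ} {γ : Fin n → ℝ} (hγ : ∀ i, 0 ≤ γ i) :
    0 ≤ pickScore h L s γ := Finset.sum_nonneg fun i _ => hγ i

theorem exists_mem_pick_le {h L s : ℕ} {γ : Fin n → ℝ} {i : Fin n}
    (hi : Acceptable h L s γ i) : ∃ p ∈ pick h L s γ, p ≤ i ∧ Acceptable h L s γ p := by
  classical
  obtain ⟨p, hp, hmin⟩ := (Finset.univ.filter (Acceptable h L s γ)).exists_min_image id
    ⟨i, by simp [hi]⟩
  simp only [Finset.mem_filter, Finset.mem_univ, true_and, id] at hp hmin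
  exact ⟨p, by simpa [pick, hp] using fun a ha hacc => absurd (hmin a hacc) (not_le.2 ha),
    hmin i hi, hp⟩

/-- If the maximum `γ j` of the sample is at least every score of the block apart from that of `i`,
then the pick scores at least `γ i`, provided that `i` comes in the strict part of the block when
`γ j < γ i`, and in its last part otherwise. In the first case `i` is the only acceptable round of
the strict part; in the second case every acceptable round will do. -/
theorem le_pickScore {h s : ℕ} {γ : Fin n → ℝ} {i j : Fin n}
    (hj : s ≤ j.1 ∧ j.1 < s + h) (hji : γ j ≤ γ i)
    (hi : (γ j < γ i → s + h ≤ i.1 ∧ i.1 < s + 2 * h) ∧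
      (¬ γ j < γ i → s + 2 * h ≤ i.1 ∧ i.1 < s + 3 * h))
    (hrest : ∀ l : Fin n, s ≤ l.1 → l.1 < s + 3 * h → l ≠ i → γ l ≤ γ j) :
    γ i ≤ pickScore h (3 * h) s γ := by
  have hbd : s + h ≤ i.1 ∧ i.1 < s + 3 * h := by
    by_cases hlt : γ j < γ i
    · have := hi.1 hlt; omega
    · have := hi.2 hlt; omega
  have hsample : ∀ l : Fin n, s ≤ l.1 → l.1 < s + h → γ l ≤ γ j := fun l h1 h2 =>
    hrest l h1 (by omega) (by rintro rfl; omega)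
  have hacc : Acceptable h (3 * h) s γ i := by
    refine ⟨hbd.1, hbd.2, fun l h1 h2 => ⟨(hsample l h1 h2).trans hji, fun h3 => ?_⟩⟩
    refine lt_of_le_of_lt (hsample l h1 h2) ?_
    by_contra hlt
    have := hi.2 hlt
    omega
  obtain ⟨p, hp, hpi, hpacc⟩ := exists_mem_pick_le hacc
  rw [pickScore, pick_eq_singleton hp, Finset.sum_singleton]
  by_cases hlt : γ j < γ i
  · by_cases hpe : p = i
    · rw [hpe]
    · have h1 := hi.1 hlt
      have h2 := hrest p (by have := hpacc.1; omega) hpacc.2.1 hpe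
      have h3 := (hpacc.2.2 j hj.1 hj.2).2 (by have := Fin.le_def.1 hpi; omega)
      exact absurd h3 (not_lt.2 h2)
  · exact (not_lt.1 hlt).trans (hpacc.2.2 j hj.1 hj.2).1

/-- The rounds in which the pick may earn the score of `x` when `y` is best in the sample. -/
noncomputable def pickRounds (h s : ℕ) (γ : Fin n → ℝ) (x y : Fin n) : Finset (Fin n) :=
  open Classical in
  if γ y < γ x then Finset.univ.filter fun i : Fin n => s + h ≤ i.1 ∧ i.1 < s + 2 * h
  else Finset.univ.filter fun i : Fin n => s + 2 * h ≤ i.1 ∧ i.1 < s + 3 * h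

theorem mem_pickRounds {h s : ℕ} {γ : Fin n → ℝ} {x y i : Fin n} :
    i ∈ pickRounds h s γ x y ↔ (γ y < γ x → s + h ≤ i.1 ∧ i.1 < s + 2 * h) ∧
      (¬ γ y < γ x → s + 2 * h ≤ i.1 ∧ i.1 < s + 3 * h) := by
  unfold pickRounds
  split_ifs with hlt <;> simp [hlt]

theorem card_pickRounds {h s : ℕ} {γ : Fin n → ℝ} {x y : Fin n} (hn : s + 3 * h ≤ n) :
    (pickRounds h s γ x y).card = h := by
  unfold pickRounds
  split_ifs
  · rw [card_filter_val_mem_Ico (by omega)]; omega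
  · rw [card_filter_val_mem_Ico (by omega)]; omega

/-- The permutations that bring `x` to round `i` and `y` to round `j`, and no other element of `T`
to the block of length `L` that starts at `s`. -/
def isolatingPerms (L s : ℕ) (T : Finset (Fin n)) (x y i j : Fin n) :
    Finset (Equiv.Perm (Fin n)) :=
  (futurePerms n s).filter fun π => (π i = x ∧ π j = y) ∧
    ∀ l : Fin n, s ≤ l.1 → l.1 < s + L → l ≠ i → l ≠ j → π l ∉ T

theorem le_card_isolatingPerms {L s : ℕ} {T : Finset (Fin n)} {x y i j : Fin n}
    (hT : T ⊆ future n s) (hx : x ∈ T) (hy : y ∈ T) (hxy : x ≠ y) (hij : i ≠ j)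
    (hi : s ≤ i.1 ∧ i.1 < s + L) (hj : s ≤ j.1 ∧ j.1 < s + L) (hL : s + L ≤ n)
    (hcard : 2 * ((T.card - 2) * (L - 2)) ≤ n - s - 2) (hN : 2 < n - s) :
    (futurePerms n s).card ≤ 2 * (n - s) ^ 2 * (isolatingPerms L s T x y i j).card := by
  classical
  set G := futurePerms n s with hG
  set Q := G.filter fun π => π i = x ∧ π j = y with hQ
  set B : Finset (Fin n) :=
    ((Finset.univ.filter fun l : Fin n => s ≤ l.1 ∧ l.1 < s + L).erase i).erase j with hB
  set T' := (T.erase x).erase y with hT'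
  have hBc : B.card = L - 2 := by
    rw [hB, Finset.card_erase_of_mem (by simp [hij.symm, hj]), Finset.card_erase_of_mem
      (by simp [hi]), card_filter_val_mem_Ico hL]
    omega
  have hTc : T'.card = T.card - 2 := by
    rw [hT', Finset.card_erase_of_mem (by simp [hxy.symm, hy]), Finset.card_erase_of_mem hx]
    omega
  -- Union bound over the elements `z` that might enter the block, and the rounds `l` they enter at.
  have hsub : Q ⊆ isolatingPerms L s T x y i j ∪
      (T' ×ˢ B).biUnion fun p => G.filter fun π => (π i = x ∧ π j = y) ∧ π p.2 = p.1 := by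
    intro π hπ
    have hπ' := Finset.mem_filter.1 hπ
    by_cases hiso : π ∈ isolatingPerms L s T x y i j
    · exact Finset.mem_union_left _ hiso
    · refine Finset.mem_union_right _ ?_
      have hex : ∃ l : Fin n, s ≤ l.1 ∧ l.1 < s + L ∧ l ≠ i ∧ l ≠ j ∧ π l ∈ T := by
        by_contra hno
        push Not at hno
        exact hiso (Finset.mem_filter.2 ⟨hπ'.1, hπ'.2, hno⟩)
      obtain ⟨l, h1, h2, h3, h4, h5⟩ := hex
      refine Finset.mem_biUnion.2 ⟨(π l, l), Finset.mem_product.2 ⟨?_, ?_⟩,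
        Finset.mem_filter.2 ⟨hπ'.1, hπ'.2, rfl⟩⟩
      · refine Finset.mem_erase.2 ⟨?_, Finset.mem_erase.2 ⟨?_, h5⟩⟩
        · rw [← hπ'.2.2]; exact fun h => h4 (π.injective h)
        · rw [← hπ'.2.1]; exact fun h => h3 (π.injective h)
      · simp [B, h1, h2, h3, h4]
  have hthree : ∀ p ∈ T' ×ˢ B,
      (G.filter fun π => (π i = x ∧ π j = y) ∧ π p.2 = p.1).card * (n - s - 2) = Q.card := by
    rintro ⟨z, l⟩ hp
    simp only [Finset.mem_product, hT', hB, Finset.mem_erase, Finset.mem_filter, Finset.mem_univ,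
      true_and] at hp
    obtain ⟨⟨hzy, hzx, hzT⟩, hlj, hli, hls, -⟩ := hp
    exact card_futurePerms_three (hT hzT) (mem_future.2 hi.1)
      (mem_future.2 hj.1) (mem_future.2 hls) hzx.symm hzy.symm hij hli.symm hlj.symm
  have hbound := (Finset.card_le_card hsub).trans (Finset.card_union_le _ _)
  have hbi := Finset.card_biUnion_le (s := T' ×ˢ B)
    (t := fun p => G.filter fun π => (π i = x ∧ π j = y) ∧ π p.2 = p.1)
  have hsum : (∑ p ∈ T' ×ˢ B, (G.filter fun π => (π i = x ∧ π j = y) ∧ π p.2 = p.1).card) *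
      (n - s - 2) = (T.card - 2) * (L - 2) * Q.card := by
    rw [Finset.sum_mul, Finset.sum_congr rfl hthree, Finset.sum_const, Finset.card_product, hTc,
      hBc, smul_eq_mul]
  have htwo : Q.card * ((n - s) * (n - s - 1)) = G.card :=
    card_futurePerms_two (hT hx) (hT hy) (mem_future.2 hi.1) (mem_future.2 hj.1) hxy hij
  have hhalf : Q.card ≤ 2 * (isolatingPerms L s T x y i j).card := by
    have h1 := Nat.mul_le_mul_right (n - s - 2) (hbound.trans (Nat.add_le_add_left hbi _))
    rw [Nat.add_mul, hsum] at h1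
    have h2 := Nat.mul_le_mul_right Q.card hcard
    refine Nat.le_of_mul_le_mul_right (c := n - s - 2) ?_ (by omega)
    nlinarith
  calc G.card = Q.card * ((n - s) * (n - s - 1)) := htwo.symm
    _ ≤ 2 * (isolatingPerms L s T x y i j).card * ((n - s) * (n - s)) :=
      Nat.mul_le_mul hhalf (Nat.mul_le_mul_left _ (Nat.sub_le _ _))
    _ = _ := by ring

/-- In a random continuation the expected score of the pick of a block with a sample of size `h` is
at least `k * h ^ 2 / (2 * (n - s) ^ 2)` times the sum of the `k` largest remaining scores. -/
theorem sum_le_sum_pickScore {h s k : ℕ} {γ : Fin n → ℝ} (hγ : ∀ i, 0 ≤ γ i) (hh : 0 < h)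
    (hk : 0 < k) (hn : s + 12 * (k * h) ≤ n) {O : Finset (Fin n)} (hO : O ⊆ future n s)
    (hOk : O.card ≤ k) :
    ((futurePerms n s).card : ℝ) * (k * h ^ 2 * ∑ o ∈ O, γ o) ≤
      2 * (n - s : ℕ) ^ 2 * ∑ π ∈ futurePerms n s, pickScore h (3 * h) s (γ ∘ π) := by
  classical
  have hkh : k ≤ k * h := Nat.le_mul_of_pos_right k hh
  have hhk : h ≤ k * h := Nat.le_mul_of_pos_left h hk
  -- `T` holds the `k` best elements and `T'` the `k` next ones.
  obtain ⟨T, hTD, hTk, hTtop⟩ := exists_top_subset (future n s) γ (m := k)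
    (by rw [card_future]; omega)
  obtain ⟨T', hTD', hTk', hTtop'⟩ := exists_top_subset (future n s \ T) γ (m := k)
    (by rw [Finset.card_sdiff_of_subset hTD, card_future]; omega)
  have hdisj : Disjoint T T' :=
    Finset.disjoint_left.2 fun x hx hx' => (Finset.mem_sdiff.1 (hTD' hx')).2 hx
  have hUD : T ∪ T' ⊆ future n s :=
    Finset.union_subset hTD (hTD'.trans Finset.sdiff_subset)
  have hUc : (T ∪ T').card = 2 * k := by
    rw [Finset.card_union_of_disjoint hdisj, hTk, hTk']; ring
  set H : Finset (Fin n) := Finset.univ.filter fun j : Fin n => s ≤ j.1 ∧ j.1 < s + h with hH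
  have hHc : H.card = h := by rw [hH, card_filter_val_mem_Ico (by omega)]; omega
  set Z : Finset (Σ _ : Fin n × Fin n, Fin n × Fin n) :=
    (T ×ˢ T').sigma fun p => pickRounds h s γ p.1 p.2 ×ˢ H with hZ
  let E : (Σ _ : Fin n × Fin n, Fin n × Fin n) → Finset (Equiv.Perm (Fin n)) := fun q =>
    isolatingPerms (3 * h) s (T ∪ T') q.1.1 q.1.2 q.2.1 q.2.2
  have hmemZ : ∀ x y i j : Fin n, (⟨(x, y), (i, j)⟩ : Σ _ : Fin n × Fin n, Fin n × Fin n) ∈ Z ↔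
      (x ∈ T ∧ y ∈ T') ∧ i ∈ pickRounds h s γ x y ∧ (s ≤ j.1 ∧ j.1 < s + h) := by
    intro x y i j
    simp [hZ, hH]
  have hpick : ∀ x y i : Fin n, i ∈ pickRounds h s γ x y → s + h ≤ i.1 ∧ i.1 < s + 3 * h := by
    intro x y i hi
    rw [mem_pickRounds] at hi
    by_cases hlt : γ y < γ x
    · have := hi.1 hlt; omega
    · have := hi.2 hlt; omega
  have hscore : ∀ π ∈ futurePerms n s,
      ∑ q ∈ Z.filter fun q => π ∈ E q, γ q.1.1 ≤ pickScore h (3 * h) s (γ ∘ π) := by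
    intro π hπ
    -- At most one of the events occurs: `i` and `j` are the only rounds of the block whose
    -- elements are in `T ∪ T'`, and `j` comes before `i`.
    have huniq : ∀ q ∈ Z.filter fun q => π ∈ E q, ∀ q' ∈ Z.filter fun q => π ∈ E q, q = q' := by
      rintro ⟨⟨x, y⟩, i, j⟩ hq ⟨⟨x', y'⟩, i', j'⟩ hq'
      rw [Finset.mem_filter, hmemZ] at hq hq'
      obtain ⟨⟨⟨hx, hy⟩, hi, hj⟩, hE⟩ := hq
      obtain ⟨⟨⟨hx', hy'⟩, hi', hj'⟩, hE'⟩ := hq'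
      obtain ⟨-, ⟨hix, hjy⟩, hE⟩ := Finset.mem_filter.1 hE
      obtain ⟨-, ⟨hix', hjy'⟩, hE'⟩ := Finset.mem_filter.1 hE'
      simp only at hix hjy hix' hjy' hE hE'
      have hbi := hpick _ _ _ hi
      have hbi' := hpick _ _ _ hi'
      have hii : i' = i := by
        by_contra hne
        refine hE i' (by omega) (by omega) hne (fun h => ?_) ?_
        · rw [h] at hbi'; omega
        · rw [hix']; exact Finset.mem_union_left _ hx'
      have hjj : j' = j := by
        by_contra hne
        refine hE j' (by omega) (by omega) (fun h => ?_) hne ?_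
        · rw [h] at hj'; omega
        · rw [hjy']; exact Finset.mem_union_right _ hy'
      subst hii hjj
      rw [← hix, ← hjy, ← hix', ← hjy']
    rcases (Z.filter fun q => π ∈ E q).eq_empty_or_nonempty with he | ⟨q, hq⟩
    · rw [he, Finset.sum_empty]
      exact pickScore_nonneg fun i => hγ _
    · rw [Finset.eq_singleton_iff_unique_mem.2 ⟨hq, fun q' hq' => huniq q' hq' q hq⟩,
        Finset.sum_singleton]
      obtain ⟨⟨x, y⟩, i, j⟩ := q
      rw [Finset.mem_filter, hmemZ] at hq
      obtain ⟨⟨⟨hx, hy⟩, hi, hj⟩, hE⟩ := hq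
      obtain ⟨-, ⟨hix, hjy⟩, hE⟩ := Finset.mem_filter.1 hE
      simp only at hix hjy hE ⊢
      rw [mem_pickRounds] at hi
      have hyx : γ y ≤ γ x := hTtop x hx y (hTD' hy)
      have := le_pickScore (γ := γ ∘ π) (i := i) (j := j) hj
        (by simpa only [Function.comp_apply, hix, hjy] using hyx)
        (by simpa only [Function.comp_apply, hix, hjy] using hi) (fun l h1 h2 hli => by
          by_cases hlj : l = j
          · rw [hlj]
          · have hl := hE l h1 h2 hli hlj
            rw [Finset.mem_union, not_or] at hl
            rw [Function.comp_apply, Function.comp_apply, hjy]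
            refine hTtop' y hy _ (Finset.mem_sdiff.2 ⟨Finset.mem_sdiff.2 ⟨?_, hl.1⟩, hl.2⟩)
            have := symm_mem_future (s := s) (π := π.symm) (x := l) ?_ (mem_future.2 h1)
            · simpa using this
            · rw [mem_futurePerms] at hπ ⊢
              intro a ha
              rw [Equiv.symm_apply_eq, hπ a ha])
      simpa only [Function.comp_apply, hix] using this
  have hcount : ∀ q ∈ Z, ((futurePerms n s).card : ℝ) ≤ 2 * (n - s : ℕ) ^ 2 * (E q).card := by
    rintro ⟨⟨x, y⟩, i, j⟩ hq
    rw [hmemZ] at hq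
    obtain ⟨⟨hx, hy⟩, hi, hj⟩ := hq
    have hbi := hpick _ _ _ hi
    have := le_card_isolatingPerms (L := 3 * h) (s := s) (x := x) (y := y) (i := i) (j := j) hUD
      (Finset.mem_union_left _ hx) (Finset.mem_union_right _ hy)
      (fun h => Finset.disjoint_left.1 hdisj hx (h ▸ hy))
      (fun h => by rw [h] at hbi; omega) (by omega) (by omega) (by omega)
      (by
        rw [hUc]
        calc 2 * ((2 * k - 2) * (3 * h - 2)) = 4 * ((k - 1) * (3 * h - 2)) := by
              rw [show 2 * k - 2 = 2 * (k - 1) by omega]; ring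
          _ ≤ 4 * ((k - 1) * (3 * h)) := by gcongr; omega
          _ = 12 * (k * h) - 12 * h := by
              rw [Nat.sub_mul, Nat.mul_sub]; congr 1 <;> ring
          _ ≤ n - s - 2 := by omega)
      (by omega)
    exact_mod_cast this
  have hZsum : ∑ q ∈ Z, γ q.1.1 = k * h ^ 2 * ∑ x ∈ T, γ x := by
    rw [hZ, Finset.sum_sigma, Finset.sum_product, Finset.mul_sum]
    refine Finset.sum_congr rfl fun x _ => ?_
    simp only [Finset.sum_const, Finset.card_product, hHc, hTk', nsmul_eq_mul,
      card_pickRounds (show s + 3 * h ≤ n by omega)]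
    push_cast
    ring
  calc ((futurePerms n s).card : ℝ) * (k * h ^ 2 * ∑ o ∈ O, γ o)
      ≤ (futurePerms n s).card * (k * h ^ 2 * ∑ x ∈ T, γ x) := by
        refine mul_le_mul_of_nonneg_left (mul_le_mul_of_nonneg_left ?_ (by positivity))
          (Nat.cast_nonneg _)
        exact sum_le_sum_of_top hγ hTtop hO (by omega)
    _ = ∑ q ∈ Z, (futurePerms n s).card * γ q.1.1 := by rw [← hZsum, Finset.mul_sum]
    _ ≤ ∑ q ∈ Z, 2 * (n - s : ℕ) ^ 2 * (E q).card * γ q.1.1 :=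
        Finset.sum_le_sum fun q hq => mul_le_mul_of_nonneg_right (hcount q hq) (hγ _)
    _ = 2 * (n - s : ℕ) ^ 2 * ∑ q ∈ Z, ∑ π ∈ futurePerms n s, if π ∈ E q then γ q.1.1 else 0 := by
        rw [Finset.mul_sum]
        refine Finset.sum_congr rfl fun q _ => ?_
        rw [← Finset.sum_filter, Finset.sum_const, nsmul_eq_mul, mul_assoc]
        congr 4
        ext π
        simp only [E, isolatingPerms, Finset.mem_filter]
        tauto
    _ ≤ 2 * (n - s : ℕ) ^ 2 * ∑ π ∈ futurePerms n s, pickScore h (3 * h) s (γ ∘ π) := by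
        rw [Finset.sum_comm]
        gcongr with π hπ
        rw [← Finset.sum_filter]
        exact hscore π hπ

/-- A block of a single round without a sample picks a uniformly random remaining element. -/
theorem sum_le_sum_pickScore_single {s : ℕ} {γ : Fin n → ℝ} (hγ : ∀ i, 0 ≤ γ i) (hs : s < n)
    {O : Finset (Fin n)} (hO : O ⊆ future n s) :
    ((futurePerms n s).card : ℝ) * ∑ o ∈ O, γ o ≤
      n * ∑ π ∈ futurePerms n s, pickScore 0 1 s (γ ∘ π) := by
  classical
  set i : Fin n := ⟨s, hs⟩
  have hval : ∀ δ : Fin n → ℝ, pickScore 0 1 s δ = δ i := by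
    intro δ
    have hacc : Acceptable 0 1 s δ i :=
      ⟨le_rfl, Nat.lt_succ_self s, fun l h1 h2 => by omega⟩
    obtain ⟨p, hp, -, hpacc⟩ := exists_mem_pick_le hacc
    have hpi : p = i := Fin.ext (by have := hpacc.1; have := hpacc.2.1; simp only [i]; omega)
    rw [pickScore, pick_eq_singleton hp, Finset.sum_singleton, hpi]
  simp only [hval, Function.comp_apply]
  have hi : i ∈ future n s := mem_future.2 le_rfl
  have hfib : ∑ π ∈ futurePerms n s, γ (π i) =
      ∑ x ∈ future n s, ((futurePerms n s).filter fun π => π i = x).card * γ x := by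
    rw [← Finset.sum_fiberwise_of_maps_to (t := future n s) (g := fun π => π i)]
    · refine Finset.sum_congr rfl fun x _ => ?_
      rw [← nsmul_eq_mul, ← Finset.sum_const]
      exact Finset.sum_congr rfl fun π hπ => by rw [(Finset.mem_filter.1 hπ).2]
    · intro π hπ
      have := symm_mem_future (s := s) (π := π.symm) (x := i) ?_ hi
      · simpa using this
      · rw [mem_futurePerms] at hπ ⊢
        intro a ha
        rw [Equiv.symm_apply_eq, hπ a ha]
  rw [hfib, Finset.mul_sum, Finset.mul_sum]
  refine (Finset.sum_le_sum_of_subset_of_nonneg hO fun x _ _ => mul_nonneg (Nat.cast_nonneg _)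
    (hγ x)).trans (Finset.sum_le_sum fun x hx => ?_)
  rw [← mul_assoc]
  refine mul_le_mul_of_nonneg_right ?_ (hγ x)
  rw [← card_futurePerms_one hx hi, mul_comm]
  push_cast
  gcongr
  exact Nat.sub_le _ _

end Pick

/-! ### Exchange between independent sets -/

namespace Matroid

variable {α : Type*} {M : Matroid α}

/-- An element spanned by an independent set `S` is spanned by those elements of `S` for which it
can be exchanged. -/
theorem Indep.mem_closure_exchange {S : Set α} {o : α} (hS : M.Indep S) (hcl : o ∈ M.closure S)
    (ho : o ∉ S) : o ∈ M.closure {s ∈ S | M.Indep (insert o S \ {s})} := by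
  have hC := hS.fundCircuit_isCircuit hcl ho
  refine M.closure_subset_closure ?_ (hC.mem_closure_sdiff_singleton_of_mem (M.mem_fundCircuit o S))
  rintro s ⟨hs, hso⟩
  rw [Set.mem_singleton_iff] at hso
  exact ⟨(M.fundCircuit_subset_insert o S hs).resolve_left hso,
    (hS.mem_fundCircuit_iff hcl ho).1 hs⟩

/-- The elements of an independent set `O` that are spanned by an independent set `S` can be
exchanged for distinct elements of `S`, each of them by itself. -/
theorem Indep.exists_injective_exchange [DecidableEq α] {S O : Finset α}
    (hS : M.Indep (S : Set α)) (hO : M.Indep (O : Set α))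
    (hspan : ∀ o ∈ O, o ∉ S ∧ o ∈ M.closure S) :
    ∃ π : O → α, Function.Injective π ∧
      ∀ o : O, π o ∈ S ∧ M.Indep (insert o.1 (S.erase (π o)) : Finset α) := by
  classical
  let N : O → Finset α := fun o => S.filter fun s => M.Indep (insert o.1 (S : Set α) \ {s})
  have hall : ∀ X : Finset O, X.card ≤ (X.biUnion N).card := by
    intro X
    have hsub : ((X.map (Function.Embedding.subtype _) : Finset α) : Set α) ⊆
        M.closure (X.biUnion N : Finset α) := by
      intro o ho
      obtain ⟨o', ho', rfl⟩ := Finset.mem_map.1 (Finset.mem_coe.1 ho)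
      have h1 := hS.mem_closure_exchange (hspan o'.1 o'.2).2
        (fun h => (hspan o'.1 o'.2).1 (Finset.mem_coe.1 h))
      refine M.closure_subset_closure ?_ h1
      rintro s ⟨hs, hs'⟩
      exact Finset.mem_coe.2 (Finset.mem_biUnion.2 ⟨o', ho', Finset.mem_filter.2 ⟨hs, hs'⟩⟩)
    have hind : M.Indep ((X.map (Function.Embedding.subtype _) : Finset α) : Set α) :=
      hO.subset fun o ho => by
        obtain ⟨o', -, rfl⟩ := Finset.mem_map.1 (Finset.mem_coe.1 ho)
        exact o'.2
    have h2 := (hind.encard_le_eRk_of_subset hsub).trans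
      ((M.eRk_closure_eq _).le.trans (M.eRk_le_encard _))
    rw [Set.encard_coe_eq_coe_finsetCard, Set.encard_coe_eq_coe_finsetCard, Finset.card_map] at h2
    exact_mod_cast h2
  obtain ⟨π, hinj, hπ⟩ := (Finset.all_card_le_biUnion_card_iff_exists_injective N).1 hall
  refine ⟨π, hinj, fun o => ?_⟩
  obtain ⟨h1, h2⟩ := Finset.mem_filter.1 (hπ o)
  refine ⟨h1, h2.subset ?_⟩
  rw [Finset.coe_insert, Finset.coe_erase]
  rintro x (rfl | ⟨hx, hne⟩)
  · refine ⟨Or.inl rfl, fun h => (hspan o.1 o.2).1 ?_⟩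
    rw [Set.mem_singleton_iff] at h
    rwa [h]
  · exact ⟨Or.inr hx, hne⟩

end Matroid

namespace SecretaryInstance

variable {α : Type*} (P : SecretaryInstance α)

theorem le_best {X A : Finset α} (hX : X ⊆ A) (hI : P.M.Indep (X : Set α)) :
    P.f X ≤ P.best A := by
  classical
  exact Finset.le_sup' P.f (by simpa [hI] using hX)

theorem exists_eq_best (A : Finset α) :
    ∃ X ⊆ A, P.M.Indep (X : Set α) ∧ P.f X = P.best A := by
  classical
  obtain ⟨X, hX, hXe⟩ := Finset.exists_mem_eq_sup' (s := A.powerset.filter fun S : Finset α =>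
    P.M.Indep (S : Set α)) ⟨∅, by simp⟩ P.f
  rw [Finset.mem_filter, Finset.mem_powerset] at hX
  exact ⟨X, hX.1, hX.2, hXe.symm⟩

theorem best_le {A : Finset α} {c : ℝ}
    (h : ∀ X ⊆ A, P.M.Indep (X : Set α) → P.f X ≤ c) : P.best A ≤ c := by
  obtain ⟨X, hX, hI, he⟩ := P.exists_eq_best A
  exact he ▸ h X hX hI

section Submodular

variable [DecidableEq α]

/-- Diminishing returns for the addition of one item. -/
theorem marginal_le {A B : Finset α} {o : α} (hAB : A ⊆ B) (hB : B ⊆ P.pool)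
    (ho : o ∈ P.pool) (hoB : o ∉ B) :
    P.f (insert o B) - P.f B ≤ P.f (insert o A) - P.f A := by
  have h := P.submod (insert o A) (Finset.insert_subset ho (hAB.trans hB)) B hB
  rw [Finset.insert_union, Finset.union_eq_right.2 hAB, Finset.insert_inter_of_notMem hoB,
    Finset.inter_eq_left.2 hAB] at h
  linarith

theorem le_sum_marginal {S O : Finset α} (hS : S ⊆ P.pool) (hO : O ⊆ P.pool) :
    P.f (S ∪ O) - P.f S ≤ ∑ o ∈ O, (P.f (insert o S) - P.f S) := by
  induction O using Finset.induction_on with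
  | empty => simp
  | insert a O ha ih =>
    have haP : a ∈ P.pool := hO (Finset.mem_insert_self _ _)
    have hOP : O ⊆ P.pool := (Finset.subset_insert _ _).trans hO
    rw [Finset.sum_insert ha, Finset.union_insert]
    have h2 := ih hOP
    by_cases haS : a ∈ S ∪ O
    · rw [Finset.insert_eq_of_mem haS]
      have := P.mono S hS (insert a S) (Finset.insert_subset haP hS) (Finset.subset_insert _ _)
      linarith
    · have := P.marginal_le (Finset.subset_union_left (s₁ := S) (s₂ := O))
        (Finset.union_subset hS hOP) haP haS
      linarith

/-- The losses from deleting single items add up to at most the value of the set. -/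
theorem sum_loss_le {S T : Finset α} (hS : S ⊆ P.pool) (hT : T ⊆ S) :
    ∑ x ∈ T, (P.f S - P.f (S.erase x)) ≤ P.f S := by
  suffices h : ∑ x ∈ T, (P.f S - P.f (S.erase x)) ≤ P.f S - P.f (S \ T) by
    have := P.nonneg (S \ T) (Finset.sdiff_subset.trans hS)
    linarith
  induction T using Finset.induction_on with
  | empty => simp
  | insert a T ha ih =>
    have haS : a ∈ S := hT (Finset.mem_insert_self _ _)
    have hTS : T ⊆ S := (Finset.subset_insert _ _).trans hT
    rw [Finset.sum_insert ha]
    have h1 := ih hTS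
    have h2 := P.marginal_le (A := S \ insert a T) (B := S.erase a) (o := a)
      (fun x hx => by
        rw [Finset.mem_sdiff, Finset.mem_insert, not_or] at hx
        exact Finset.mem_erase.2 ⟨hx.2.1, hx.1⟩)
      ((Finset.erase_subset _ _).trans hS) (hS haS) (Finset.notMem_erase a S)
    rw [Finset.insert_erase haS] at h2
    have h3 : insert a (S \ insert a T) = S \ T := by
      ext x
      simp only [Finset.mem_insert, Finset.mem_sdiff]
      by_cases hxa : x = a
      · subst hxa; simp [haS, ha]
      · simp [hxa]
    rw [h3] at h2
    linarith

/-- The local search inequality: if all gains of a solution `S` are small, then so is the value of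
any other independent set `O`. -/
theorem sub_le_sum_gain {S O : Finset α} (hS : S ⊆ P.pool) (hO : O ⊆ P.pool)
    (hSI : P.M.Indep (S : Set α)) (hOI : P.M.Indep (O : Set α)) :
    P.f O - 2 * P.f S ≤ ∑ o ∈ O, (P.best (insert o S) - P.f S) := by
  classical
  set O₁ := O.filter fun o => o ∉ S ∧ o ∈ P.M.closure S with hO₁
  have hO₁O : O₁ ⊆ O := Finset.filter_subset _ _
  obtain ⟨π, hinj, hπ⟩ := hSI.exists_injective_exchange (hOI.subset (Finset.coe_subset.2 hO₁O))
    fun o ho => (Finset.mem_filter.1 ho).2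
  have hin : ∀ o : O₁, P.f (insert o.1 S) - P.f S - (P.f S - P.f (S.erase (π o))) ≤
      P.best (insert o.1 S) - P.f S := by
    intro o
    have hoP := hO (hO₁O o.2)
    have h1 := P.marginal_le (Finset.erase_subset (π o) S) hS hoP (Finset.mem_filter.1 o.2).2.1
    have h2 := P.le_best (Finset.insert_subset_insert o.1 (Finset.erase_subset (π o) S)) (hπ o).2
    linarith
  have hout : ∀ o ∈ O \ O₁, P.f (insert o S) - P.f S ≤ P.best (insert o S) - P.f S := by
    intro o ho
    rw [Finset.mem_sdiff, hO₁, Finset.mem_filter, not_and] at ho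
    have hind : P.M.Indep (insert o S : Finset α) := by
      by_cases hoS : o ∈ S
      · rwa [Finset.insert_eq_of_mem hoS]
      · rw [Finset.coe_insert, hSI.insert_indep_iff_of_notMem hoS]
        exact ⟨P.pool_subset (hO ho.1), fun hc => ho.2 ho.1 ⟨hoS, hc⟩⟩
    have := P.le_best subset_rfl hind
    linarith
  have hloss : ∑ o : O₁, (P.f S - P.f (S.erase (π o))) ≤ P.f S := by
    have h := P.sum_loss_le hS (T := Finset.univ.map ⟨π, hinj⟩) fun x hx => by
      obtain ⟨o, -, rfl⟩ := Finset.mem_map.1 hx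
      exact (hπ o).1
    rwa [Finset.sum_map] at h
  have hsum := Finset.sum_le_sum fun o (_ : o ∈ (Finset.univ : Finset O₁)) => hin o
  rw [Finset.sum_sub_distrib, Finset.sum_coe_sort O₁ fun o => P.f (insert o S) - P.f S,
    Finset.sum_coe_sort O₁ fun o => P.best (insert o S) - P.f S] at hsum
  have hmarg := P.le_sum_marginal hS hO
  have hmono := P.mono O hO (S ∪ O) (Finset.union_subset hS hO) Finset.subset_union_right
  rw [← Finset.sum_sdiff hO₁O] at hmarg ⊢
  have := Finset.sum_le_sum hout
  linarith

/-- If every item of `A` belongs to at least half of the sets `R i`, then the average value of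
`A ∩ R i` is at least half the value of `A`. -/
theorem half_le_sum_inter {ι : Type*} [Fintype ι] (R : ι → Finset α) {A : Finset α}
    (hA : A ⊆ P.pool)
    (hR : ∀ a ∈ A, Fintype.card ι ≤ 2 * (Finset.univ.filter fun i => a ∈ R i).card) :
    (Fintype.card ι : ℝ) * P.f A ≤ 2 * ∑ i, P.f (A ∩ R i) := by
  induction A using Finset.induction_on with
  | empty =>
    have := P.nonneg ∅ (by simp)
    simp only [Finset.empty_inter, Finset.sum_const, Finset.card_univ, nsmul_eq_mul]
    nlinarith [mul_nonneg (Nat.cast_nonneg (α := ℝ) (Fintype.card ι)) this]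
  | insert a A ha ih =>
    have haP : a ∈ P.pool := hA (Finset.mem_insert_self _ _)
    have hAP : A ⊆ P.pool := (Finset.subset_insert _ _).trans hA
    have h1 := ih hAP fun x hx => hR x (Finset.mem_insert_of_mem hx)
    have h2 : ∀ i, P.f (A ∩ R i) + (if a ∈ R i then P.f (insert a A) - P.f A else 0) ≤
        P.f (insert a A ∩ R i) := by
      intro i
      split_ifs with hi
      · rw [Finset.insert_inter_of_mem hi]
        have := P.marginal_le (Finset.inter_subset_left (s₁ := A) (s₂ := R i)) hAP haP ha
        linarith
      · rw [Finset.insert_inter_of_notMem hi, add_zero]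
    have h3 := Finset.sum_le_sum fun i (_ : i ∈ Finset.univ) => h2 i
    rw [Finset.sum_add_distrib, ← Finset.sum_filter, Finset.sum_const, nsmul_eq_mul] at h3
    have h4 : (Fintype.card ι : ℝ) ≤
        2 * ((Finset.univ.filter fun i => a ∈ R i).card : ℝ) := by
      exact_mod_cast hR a (Finset.mem_insert_self _ _)
    have h5 : 0 ≤ P.f (insert a A) - P.f A := sub_nonneg.2
      (P.mono A hAP (insert a A) hA (Finset.subset_insert _ _))
    nlinarith

end Submodular

end SecretaryInstance

/-! ### The parameters of the algorithm -/

/-- The length of the sample of each block, for `n` items and rank `k`. It vanishes when `n` is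
smaller than a multiple of `k`. -/
def sampleLength (n k : ℕ) : ℕ := n / (24 * k)

/-- The length of a block: a sample and two selection phases of the same length, or a single
round. -/
def blockLength (n k : ℕ) : ℕ := max 1 (3 * sampleLength n k)

/-- The number of blocks. -/
def numBlocks (n k : ℕ) : ℕ := min k ((n + 1) / 2)

section Parameters

variable {n k : ℕ}

theorem sampleLength_mul_le : 24 * (k * sampleLength n k) ≤ n := by
  have := Nat.mul_div_le n (24 * k)
  rwa [Nat.mul_assoc] at this

theorem blockLength_pos : 0 < blockLength n k := lt_max_of_lt_left one_pos

theorem two_mul_blockLength_le {b : ℕ} (hb : b < numBlocks n k) :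
    2 * (b * blockLength n k) ≤ n := by
  have h1 := sampleLength_mul_le (n := n) (k := k)
  unfold blockLength numBlocks at *
  rcases Nat.eq_zero_or_pos (sampleLength n k) with h0 | h0
  · rw [h0, Nat.mul_zero, max_eq_left (by omega)]
    omega
  · rw [max_eq_right (by omega)]
    have : b * sampleLength n k ≤ k * sampleLength n k := Nat.mul_le_mul_right _ (by omega)
    have : b * (3 * sampleLength n k) = 3 * (b * sampleLength n k) := by ring
    omega

theorem numBlocks_mul_blockLength_le : numBlocks n k * blockLength n k ≤ n := by
  have h1 := sampleLength_mul_le (n := n) (k := k)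
  unfold blockLength numBlocks at *
  rcases Nat.eq_zero_or_pos (sampleLength n k) with h0 | h0
  · rw [h0, Nat.mul_zero, max_eq_left (by omega)]
    omega
  · rw [max_eq_right (by omega)]
    have : min k ((n + 1) / 2) * sampleLength n k ≤ k * sampleLength n k :=
      Nat.mul_le_mul_right _ (by omega)
    have : min k ((n + 1) / 2) * (3 * sampleLength n k) =
      3 * (min k ((n + 1) / 2) * sampleLength n k) := by ring
    omega

/-- In every block the pick earns, in expectation over the continuation, at least the fraction
`1 / (4608 * r)` of the total score of any `k` remaining elements, `r` being the number of
blocks. The constant is `2 * 48 ^ 2`, since `n ≤ 48 * k * h` for a sample of positive size `h`; for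
blocks of a single round `n` is at most a small multiple of `r`. -/
theorem sum_le_sum_pickScore_block {b : ℕ} (hb : b < numBlocks n k) {γ : Fin n → ℝ}
    (hγ : ∀ i, 0 ≤ γ i) {O : Finset (Fin n)} (hO : O ⊆ future n (b * blockLength n k))
    (hOk : O.card ≤ k) :
    ((futurePerms n (b * blockLength n k)).card : ℝ) * ∑ o ∈ O, γ o ≤
      4608 * numBlocks n k * ∑ π ∈ futurePerms n (b * blockLength n k),
        pickScore (sampleLength n k) (blockLength n k) (b * blockLength n k) (γ ∘ π) := by
  have hr : 0 < numBlocks n k := by omega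
  have hk : 0 < k := by unfold numBlocks at hr; omega
  have h1 := sampleLength_mul_le (n := n) (k := k)
  have h2 : n < 24 * k * (sampleLength n k + 1) := Nat.lt_mul_div_succ n (by omega)
  have hs2 := two_mul_blockLength_le hb
  have hrb : numBlocks n k = min k ((n + 1) / 2) := rfl
  rcases Nat.eq_zero_or_pos (sampleLength n k) with h0 | h0
  · have hL : blockLength n k = 1 := by rw [blockLength, h0]; rfl
    rw [h0] at h2 ⊢
    rw [hL] at hO hs2 ⊢
    refine (sum_le_sum_pickScore_single hγ (by omega) hO).trans
      (mul_le_mul_of_nonneg_right ?_ (Finset.sum_nonneg fun π _ =>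
        pickScore_nonneg fun i => hγ _))
    have : n ≤ 4608 * numBlocks n k := by omega
    exact_mod_cast this
  · have hL : blockLength n k = 3 * sampleLength n k := max_eq_right (by omega)
    set h := sampleLength n k
    have hkh : k ≤ k * h := Nat.le_mul_of_pos_right k h0
    have hrk : numBlocks n k = k := by omega
    have hn : n ≤ 48 * (k * h) := by
      have : 24 * k * (h + 1) = 24 * (k * h) + 24 * k := by ring
      omega
    rw [hL] at hO hs2 ⊢
    rw [hrk] at hb ⊢
    have hbk : b * (3 * h) ≤ 3 * (k * h) := by
      calc b * (3 * h) ≤ k * (3 * h) := Nat.mul_le_mul_right _ hb.le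
        _ = _ := by ring
    have hmain := sum_le_sum_pickScore hγ h0 hk (s := b * (3 * h)) (by omega) hO hOk
    set s := b * (3 * h)
    set X := ∑ π ∈ futurePerms n s, pickScore h (3 * h) s (γ ∘ π)
    have hX : 0 ≤ X := Finset.sum_nonneg fun π _ => pickScore_nonneg fun i => hγ _
    have hc : (2 * (n - s : ℕ) ^ 2 : ℝ) ≤ k * h ^ 2 * (4608 * k) := by
      have : 2 * (n - s) ^ 2 ≤ k * h ^ 2 * (4608 * k) := by
        calc 2 * (n - s) ^ 2 ≤ 2 * (48 * (k * h)) ^ 2 := by gcongr; omega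
          _ = _ := by ring
      exact_mod_cast this
    have hpos : (0 : ℝ) < k * h ^ 2 := by positivity
    refine le_of_mul_le_mul_left ?_ hpos
    calc (k * h ^ 2 : ℝ) * ((futurePerms n s).card * ∑ o ∈ O, γ o)
        = (futurePerms n s).card * (k * h ^ 2 * ∑ o ∈ O, γ o) := by ring
      _ ≤ 2 * (n - s : ℕ) ^ 2 * X := hmain
      _ ≤ k * h ^ 2 * (4608 * k) * X := mul_le_mul_of_nonneg_right hc hX
      _ = _ := by ring

end Parameters

/-! ### The expected value of the solution -/

namespace SecretaryInstance

variable {α : Type*} (P : SecretaryInstance α)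

theorem mem_items {σ : P.Order} {X : Finset (Fin P.pool.card)} {a : α} :
    a ∈ P.items σ X ↔ ∃ i ∈ X, (σ i : α) = a := by
  simp [items]

theorem items_subset_pool (σ : P.Order) (X : Finset (Fin P.pool.card)) :
    P.items σ X ⊆ P.pool := fun a ha => by
  obtain ⟨i, -, rfl⟩ := P.mem_items.1 ha
  exact (σ i).2

theorem items_mono (σ : P.Order) {X Y : Finset (Fin P.pool.card)} (h : X ⊆ Y) :
    P.items σ X ⊆ P.items σ Y := Finset.map_subset_map.2 h

theorem items_insert [DecidableEq α] (σ : P.Order) (j : Fin P.pool.card)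
    (X : Finset (Fin P.pool.card)) :
    P.items σ (insert j X) = insert (σ j : α) (P.items σ X) := by
  rw [items, Finset.map_insert]; rfl

theorem items_trans (σ : P.Order) (π : Equiv.Perm (Fin P.pool.card))
    (X : Finset (Fin P.pool.card)) :
    P.items (π.trans σ) X = P.items σ (X.map π.toEmbedding) := by
  rw [items, items, Finset.map_map]; rfl

theorem map_eq_self_of_subset_past {s : ℕ} {π : Equiv.Perm (Fin P.pool.card)}
    (hπ : π ∈ futurePerms P.pool.card s) {X : Finset (Fin P.pool.card)}
    (hX : X ⊆ past P.pool.card s) : X.map π.toEmbedding = X := by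
  ext i
  simp only [Finset.mem_map, Equiv.coe_toEmbedding]
  have hfix : ∀ a ∈ X, π a = a := fun a ha => mem_futurePerms.1 hπ a (mem_past.1 (hX ha))
  exact ⟨fun ⟨a, ha, hai⟩ => hai ▸ (hfix a ha).symm ▸ ha, fun hi => ⟨i, hi, hfix i hi⟩⟩

theorem roundValue_bestSubset (σ : P.Order) (A : Finset (Fin P.pool.card)) :
    P.roundValue σ (bestSubset (P.roundValue σ) (P.RoundIndep σ) A) = P.best (P.items σ A) := by
  classical
  obtain ⟨h1, h2, h3⟩ := bestSubset_spec (v := P.roundValue σ) (P.roundIndep_empty σ) A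
  refine le_antisymm (P.le_best (P.items_mono σ h1) h2) (P.best_le fun X hX hI => ?_)
  obtain ⟨Y, hY, rfl⟩ := Finset.subset_map_iff.1 hX
  exact h3 Y hY hI

theorem gain_eq (σ : P.Order) (S : Finset (Fin P.pool.card)) (j : Fin P.pool.card) :
    gain (P.roundValue σ) (P.RoundIndep σ) S j =
      P.best (P.items σ (insert j S)) - P.f (P.items σ S) := by
  rw [gain, roundValue_bestSubset]; rfl

/-- The rounds of the solution after `b` blocks under the arrival order `σ`. -/
noncomputable def solution (h L : ℕ) (σ : P.Order) (b : ℕ) : Finset (Fin P.pool.card) :=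
  blockSolution h L (P.roundValue σ) (P.RoundIndep σ) b

/-- The gains of the rounds relative to the solution after `b` blocks. -/
noncomputable def gains (h L : ℕ) (σ : P.Order) (b : ℕ) : Fin P.pool.card → ℝ :=
  gain (P.roundValue σ) (P.RoundIndep σ) (P.solution h L σ b)

variable {h L : ℕ}

/-- A permutation of the rounds after the first `b` blocks does not change the solution at that
time, and permutes the gains. -/
theorem gains_trans (σ : P.Order) {b : ℕ} {π : Equiv.Perm (Fin P.pool.card)}
    (hπ : π ∈ futurePerms P.pool.card (b * L)) :
    P.gains h L (π.trans σ) b = P.gains h L σ b ∘ π := by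
  classical
  have hsol : P.solution h L (π.trans σ) b = P.solution h L σ b := by
    refine AgreeOn.blockSolution_eq (P.roundIndep_empty _) fun X hX => ?_
    rw [roundValue, RoundIndep, items_trans, P.map_eq_self_of_subset_past hπ hX]
    exact ⟨rfl, Iff.rfl⟩
  have hfix := P.map_eq_self_of_subset_past hπ
    (blockSolution_spec (v := P.roundValue σ) (h := h) (L := L) (P.roundIndep_empty σ) b).1
  funext j
  rw [gains, hsol, Function.comp_apply, gains, gain_eq, gain_eq, items_trans, items_trans,
    Finset.map_insert]
  unfold solution
  rw [hfix]
  rfl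

open Classical in
theorem sum_order_trans (X : P.Order → ℝ) (G : Finset (Equiv.Perm (Fin P.pool.card))) :
    ∑ σ : P.Order, ∑ π ∈ G, X (π.trans σ) = G.card * ∑ σ : P.Order, X σ := by
  rw [Finset.sum_comm, ← nsmul_eq_mul, ← Finset.sum_const]
  refine Finset.sum_congr rfl fun π _ => ?_
  exact Fintype.sum_equiv (Equiv.mk (fun σ => π.trans σ) (fun σ => π.symm.trans σ)
    (fun σ => by ext; simp) (fun σ => by ext; simp)) _ _ fun σ => rfl

open Classical in
/-- An item arrives in the second half of the rounds, or any longer final segment, in at least half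
of the orders. -/
theorem card_order_le {s : ℕ} (hs : 2 * s ≤ P.pool.card) {a : α} (ha : a ∈ P.pool) :
    Fintype.card P.Order ≤ 2 * (Finset.univ.filter fun σ : P.Order =>
      a ∈ P.items σ (future P.pool.card s)).card := by
  set n := P.pool.card with hn
  have hone : ∀ l : Fin n, (Finset.univ.filter fun σ : P.Order => σ l = ⟨a, ha⟩).card * n =
      Fintype.card P.Order := by
    intro l
    have := card_filter_apply_eq_mul_card (Finset.univ : Finset P.Order) Finset.univ
      (by simp) (z := ⟨a, ha⟩) (by simp) (Finset.mem_univ l)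
    rwa [Finset.card_univ, Fintype.card_fin] at this
  have hpos : 0 < n := Finset.card_pos.2 ⟨a, ha⟩
  have hfib : (Finset.univ.filter fun σ : P.Order => a ∈ P.items σ (future n s)).card * n =
      (n - s) * Fintype.card P.Order := by
    rw [Finset.card_eq_sum_card_fiberwise (f := fun σ : P.Order => σ.symm ⟨a, ha⟩)
      (t := future n s), Finset.sum_mul, ← card_future, ← smul_eq_mul, ← Finset.sum_const]
    · refine Finset.sum_congr rfl fun l hl => ?_
      rw [← hone l, Finset.filter_filter]
      congr 2
      ext σ
      simp only [Finset.mem_filter, Finset.mem_univ, true_and]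
      constructor
      · rintro ⟨-, h2⟩
        rw [← h2, Equiv.apply_symm_apply]
      · intro h1
        exact ⟨P.mem_items.2 ⟨l, hl, by rw [h1]⟩, by rw [← h1, Equiv.symm_apply_apply]⟩
    · intro σ hσ
      obtain ⟨i, hi, hia⟩ := P.mem_items.1 (Finset.mem_filter.1 hσ).2
      have : σ.symm ⟨a, ha⟩ = i := by rw [Equiv.symm_apply_eq]; exact Subtype.ext hia.symm
      simpa [this] using hi
  refine Nat.le_of_mul_le_mul_right (c := n) ?_ hpos
  rw [Nat.mul_assoc, hfib]
  calc Fintype.card P.Order * n ≤ Fintype.card P.Order * (2 * (n - s)) :=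
        Nat.mul_le_mul_left _ (by omega)
    _ = _ := by ring

open Classical in
/-- In every block the expected value of the solution increases by a fraction `1 / (4608 * r)` of
the amount by which twice this value falls short of half the optimum. -/
theorem expected_increase {k b : ℕ} (hk : P.M.eRank = k) (hb : b < numBlocks P.pool.card k) :
    Fintype.card P.Order * P.opt / 2 - 2 * ∑ σ : P.Order, P.f (P.items σ
        (P.solution (sampleLength P.pool.card k) (blockLength P.pool.card k) σ b)) ≤
      4608 * numBlocks P.pool.card k *
        (∑ σ : P.Order, P.f (P.items σ
          (P.solution (sampleLength P.pool.card k) (blockLength P.pool.card k) σ (b + 1))) -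
        ∑ σ : P.Order, P.f (P.items σ
          (P.solution (sampleLength P.pool.card k) (blockLength P.pool.card k) σ b))) := by
  set n := P.pool.card with hn
  set h := sampleLength n k with hh
  set L := blockLength n k with hL
  set r := numBlocks n k with hr
  set G := futurePerms n (b * L) with hG
  obtain ⟨O, hOP, hOI, hOe⟩ := P.exists_eq_best P.pool
  have hOk : O.card ≤ k := by
    have := hOI.encard_le_eRank
    rw [hk, Set.encard_coe_eq_coe_finsetCard] at this
    exact_mod_cast this
  have hγ : ∀ σ i, 0 ≤ P.gains h L σ b i := fun σ i =>
    gain_nonneg (P.roundIndep_empty σ) (blockSolution_spec (P.roundIndep_empty σ) b).2 i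
  have hstep : ∀ σ : P.Order, P.f (P.items σ (P.solution h L σ (b + 1))) =
      P.f (P.items σ (P.solution h L σ b)) + pickScore h L (b * L) (P.gains h L σ b) :=
    fun σ => blockSolution_succ_value (v := P.roundValue σ)
  -- The gains of the optimal items that are still to come bound their value.
  have hgain : ∀ σ : P.Order,
      (G.card : ℝ) * (P.f (O ∩ P.items σ (future n (b * L))) -
        2 * P.f (P.items σ (P.solution h L σ b))) ≤
      4608 * r * ∑ π ∈ G, pickScore h L (b * L) (P.gains h L σ b ∘ π) := by
    intro σ
    set Oσ : Finset (Fin n) := (future n (b * L)).filter fun i => (σ i : α) ∈ O with hOσ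
    have hitems : O ∩ P.items σ (future n (b * L)) = P.items σ Oσ := by
      ext a
      simp only [Finset.mem_inter, P.mem_items, hOσ, Finset.mem_filter]
      constructor
      · rintro ⟨haO, i, hi, rfl⟩
        exact ⟨i, ⟨hi, haO⟩, rfl⟩
      · rintro ⟨i, ⟨hi, hiO⟩, rfl⟩
        exact ⟨hiO, i, hi, rfl⟩
    have hcard : Oσ.card ≤ k := by
      have h1 : (P.items σ Oσ).card = Oσ.card := Finset.card_map _
      rw [← h1, ← hitems]
      exact (Finset.card_le_card Finset.inter_subset_left).trans hOk
    refine le_trans (mul_le_mul_of_nonneg_left ?_ (Nat.cast_nonneg _))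
      (sum_le_sum_pickScore_block hb (hγ σ) (Finset.filter_subset _ _) hcard)
    refine (P.sub_le_sum_gain (P.items_subset_pool σ _)
      (Finset.inter_subset_left.trans hOP)
      (blockSolution_spec (P.roundIndep_empty σ) b).2
      (hOI.subset (Finset.coe_subset.2 Finset.inter_subset_left))).trans_eq ?_
    rw [hitems, items, Finset.sum_map]
    refine Finset.sum_congr rfl fun i _ => ?_
    rw [gains, gain_eq, items_insert]
    rfl
  have hsum := Finset.sum_le_sum fun σ (_ : σ ∈ (Finset.univ : Finset P.Order)) => hgain σ
  have hsymm : ∑ σ : P.Order, ∑ π ∈ G, pickScore h L (b * L) (P.gains h L σ b ∘ π) =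
      G.card * ∑ σ : P.Order, pickScore h L (b * L) (P.gains h L σ b) := by
    rw [← P.sum_order_trans (fun σ => pickScore h L (b * L) (P.gains h L σ b))]
    refine Finset.sum_congr rfl fun σ _ => Finset.sum_congr rfl fun π hπ => ?_
    rw [P.gains_trans σ hπ]
  rw [← Finset.mul_sum, ← Finset.mul_sum, hsymm, Finset.sum_sub_distrib, ← Finset.mul_sum] at hsum
  have hGpos : (0 : ℝ) < G.card := Nat.cast_pos.2 card_futurePerms_pos
  have hhalf := P.half_le_sum_inter (fun σ : P.Order => P.items σ (future n (b * L))) hOP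
    fun a ha => P.card_order_le (two_mul_blockLength_le hb) (hOP ha)
  rw [hOe] at hhalf
  have hdiff : ∑ σ : P.Order, P.f (P.items σ (P.solution h L σ (b + 1))) -
      ∑ σ : P.Order, P.f (P.items σ (P.solution h L σ b)) =
      ∑ σ : P.Order, pickScore h L (b * L) (P.gains h L σ b) := by
    rw [← Finset.sum_sub_distrib]
    exact Finset.sum_congr rfl fun σ _ => by rw [hstep σ]; ring
  rw [hdiff]
  have hdiv := le_of_mul_le_mul_left (hsum.trans_eq (mul_left_comm _ _ _)) hGpos
  unfold opt
  linarith

open Classical in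
/-- Summing the increases over the `r` blocks, where each value is at most the final one, bounds the
optimum by `2 * (4608 + 2)` times the expected final value. -/
theorem opt_le_sum_solution {k : ℕ} (hk : P.M.eRank = k) :
    Fintype.card P.Order * P.opt ≤ 9220 * ∑ σ : P.Order, P.f (P.items σ
      (P.solution (sampleLength P.pool.card k) (blockLength P.pool.card k) σ
        (numBlocks P.pool.card k))) := by
  set n := P.pool.card with hn
  set h := sampleLength n k with hh
  set L := blockLength n k with hL
  set r := numBlocks n k with hr
  have hf : ∀ σ b, 0 ≤ P.f (P.items σ (P.solution h L σ b)) := fun σ b =>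
    P.nonneg _ (P.items_subset_pool σ _)
  rcases Nat.eq_zero_or_pos r with hr0 | hrpos
  · -- Either there are no items or the rank is zero, so that only the empty set is feasible.
    have hopt : P.opt ≤ P.f ∅ := P.best_le fun X hX hI => by
      have hXk : X.card ≤ k := by
        have := hI.encard_le_eRank
        rw [hk, Set.encard_coe_eq_coe_finsetCard] at this
        exact_mod_cast this
      have hXn := Finset.card_le_card hX
      have : r = min k ((n + 1) / 2) := rfl
      have hX0 : X = ∅ := Finset.card_eq_zero.1 (by omega)
      rw [hX0]
    have hle : ∀ σ : P.Order, P.opt ≤ P.f (P.items σ (P.solution h L σ r)) := fun σ =>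
      hopt.trans (P.mono _ (by simp) _ (P.items_subset_pool σ _) (by simp))
    have h1 := Finset.card_nsmul_le_sum Finset.univ _ _ fun σ (_ : σ ∈ Finset.univ) => hle σ
    rw [Finset.card_univ, nsmul_eq_mul] at h1
    have h2 := Finset.sum_nonneg fun σ (_ : σ ∈ (Finset.univ : Finset P.Order)) => hf σ r
    linarith
  · set a : ℕ → ℝ := fun b => ∑ σ : P.Order, P.f (P.items σ (P.solution h L σ b)) with ha
    have hmono : Monotone a := monotone_nat_of_le_succ fun b =>
      Finset.sum_le_sum fun σ _ => by
        have h1 := blockSolution_succ_value (v := P.roundValue σ) (I := P.RoundIndep σ) (h := h)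
          (L := L) (b := b)
        have h2 : 0 ≤ pickScore h L (b * L) (P.gains h L σ b) := pickScore_nonneg fun i =>
          gain_nonneg (P.roundIndep_empty σ) (blockSolution_spec (P.roundIndep_empty σ) b).2 i
        change P.roundValue σ _ ≤ P.roundValue σ _
        exact h1 ▸ le_add_of_nonneg_right h2
    have h0 : 0 ≤ a 0 := Finset.sum_nonneg fun σ _ => hf σ 0
    have hinc : ∀ b ∈ Finset.range r,
        Fintype.card P.Order * P.opt / 2 - 2 * a r ≤ 4608 * r * (a (b + 1) - a b) := by
      intro b hb
      have h1 := P.expected_increase hk (Finset.mem_range.1 hb)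
      have h2 := hmono (Finset.mem_range.1 hb).le
      exact le_trans (by linarith) h1
    have hsum := Finset.sum_le_sum hinc
    rw [← Finset.mul_sum, Finset.sum_range_sub, Finset.sum_const, Finset.card_range,
      nsmul_eq_mul, mul_comm (4608 : ℝ), mul_assoc] at hsum
    have := le_of_mul_le_mul_left hsum (Nat.cast_pos.2 hrpos)
    change _ ≤ 9220 * a r
    linarith

end SecretaryInstance

/-- The block algorithm with its parameters. -/
noncomputable def blockAlgorithm : OnlineAlgorithm := fun n k =>
  blockRule n (sampleLength n k) (blockLength n k) (numBlocks n k)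

namespace SecretaryInstance

variable {α : Type*} (P : SecretaryInstance α)

open Classical in
theorem expect_blockAlgorithm {k : ℕ}
    (X : P.Order → Fin (blockAlgorithm P.pool.card k).numSeeds → ℝ) :
    P.expect (blockAlgorithm P.pool.card k) X =
      (∑ σ : P.Order, X σ (0 : Fin 1)) / Fintype.card P.Order := by
  unfold expect
  congr 1
  refine Finset.sum_congr rfl fun σ _ => ?_
  change ∑ ω : Fin 1, ((PMF.pure (0 : Fin 1)) ω).toReal * X σ ω = _
  simp

theorem le_expect_held {k : ℕ} (hk : P.M.eRank = k) :
    1 / 9220 * P.opt ≤ P.expect (blockAlgorithm P.pool.card k)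
      fun σ ω => P.f (P.held (blockAlgorithm P.pool.card k) σ ω P.pool.card) := by
  classical
  rw [expect_blockAlgorithm]
  have hpos : (0 : ℝ) < Fintype.card P.Order :=
    Nat.cast_pos.2 (Fintype.card_pos_iff.2 ⟨P.pool.equivFin.symm⟩)
  rw [le_div_iff₀ hpos]
  have hmain := P.opt_le_sum_solution hk
  have heq : ∀ (σ : P.Order) (ω : Fin (blockAlgorithm P.pool.card k).numSeeds),
      P.f (P.held (blockAlgorithm P.pool.card k) σ ω P.pool.card) =
      P.f (P.items σ (P.solution (sampleLength P.pool.card k) (blockLength P.pool.card k) σ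
        (numBlocks P.pool.card k))) := fun σ ω => by
    have h := P.heldRounds_blockRule_end σ ω blockLength_pos
      numBlocks_mul_blockLength_le numBlocks_mul_blockLength_le
    exact congrArg (fun S => P.f (P.items σ S)) h
  rw [Finset.sum_congr rfl fun σ _ => heq σ (0 : Fin 1)]
  linarith

theorem held_subset_shortlist (R : OnlineRule P.pool.card) (σ : P.Order) (ω : Fin R.numSeeds)
    (t : ℕ) : P.held R σ ω t ⊆ P.shortlist R σ ω :=
  P.items_mono σ (Finset.filter_subset _ _)

theorem expect_mono (R : OnlineRule P.pool.card) {X Y : P.Order → Fin R.numSeeds → ℝ}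
    (hXY : ∀ σ ω, X σ ω ≤ Y σ ω) : P.expect R X ≤ P.expect R Y := by
  unfold expect
  gcongr with σ _ ω _
  exact hXY σ ω

end SecretaryInstance

theorem mainTheorem2 :
    ∃ c : ℝ, 0 < c ∧ ∃ alg : OnlineAlgorithm,
      OnlineAlgorithm.IsCompetitiveWithPreemption.{u} alg c ∧
      OnlineAlgorithm.IsCompetitiveWithShortlist.{u} alg (fun k => k) c := by
  have hindep : ∀ (α : Type u) (P : SecretaryInstance α) (k : ℕ) σ ω t,
      P.M.Indep (P.held (blockAlgorithm P.pool.card k) σ ω t : Set α) :=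
    fun α P k σ ω t => P.indep_held_blockRule σ ω blockLength_pos
      numBlocks_mul_blockLength_le t
  refine ⟨1 / 9220, by norm_num, blockAlgorithm,
    fun α P k hk => ⟨hindep α P k, P.le_expect_held hk⟩, fun α P k hk => ⟨fun σ ω => ?_, ?_⟩⟩
  · exact (P.card_shortlist_blockRule_le σ ω).trans (min_le_left _ _)
  · exact (P.le_expect_held hk).trans (P.expect_mono _ fun σ ω =>
      P.le_best (P.held_subset_shortlist _ σ ω _) (hindep α P k σ ω _))
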